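/- Let $p$ be a prime, let $h\ge 1$, and let $H$ be a (one-dimensional, commutative) formal group law over $\mathbb F_p$ with $[p]_H(T)=T^{p^h}$, where $[0]_H=0$ and $[m+1]_H(T)=H([m]_H(T),T)$. For an $\mathbb F_p$-scheme $S$ put $\Gamma(S)=\Gamma(S,\mathcal O_S)$, regard $H$ as a formal group law over $\Gamma(S)$, and let $\mathcal Aut(H)$ be the presheaf of groups $S\mapsto \mathrm{Aut}_{\Gamma(S)}(H)$ on $\mathbb F_p$-schemes (power series $f$ with zero constant term and $f(H(T_1,T_2))=H(f(T_1),f(T_2))$ that are invertible under composition, with composition as group law). For $i\ge 0$ let $\mathcal A^H_i\subset \mathcal Aut(H)$ be the presheaf of normal subgroups with $\mathcal A_0^H=\mathcal Aut(H)$ and, for $i\ge 1$, $$\mathcal A_i^H(S)=\{f\in \mathrm{Aut}_{\Gamma(S)}(H) \mid f(T)=T+a_{i+1}T^{i+1}+\text{(higher order terms)}\}.$$ Let $\mu_{p^h-1}(S)=\{a\in\Gamma(S)^\times\mid a^{p^h-1}=1\}$ (under multiplication) and $\mathbb G_a^{\mathrm{Fr}_{p^h}}(S)=\{a\in\Gamma(S)\mid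 a^{p^h}=a\}$ (under addition). Then sending the class of $f$ to the coefficient of $T^{i+1}$ in $f$ induces isomorphisms of presheaves of groups on $\mathbb F_p$-schemes $$\mathcal A_i^H/\mathcal A_{i+1}^H\;\cong\;\begin{cases}\mu_{p^h-1}, & i=0;\\ \mathbb G_a^{\mathrm{Fr}_{p^h}}, & i=p^j-1 \text{ for some } j\ge 1;\\ 0, & \text{otherwise,}\end{cases}$$ where the left-hand side is the presheaf quotient $S\mapsto \mathcal A_i^H(S)/\mathcal A_{i+1}^H(S)$. -/

import Mathlib

open CategoryTheory AlgebraicGeometry Opposite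

universe u

noncomputable section

namespace FormalGroup

section Ring

variable {A : Type*} [CommRing A] {B : Type*} [CommRing B]

/-- The series `[m]_F(T)`: `[0]_F = 0` and `[m + 1]_F(T) = F([m]_F(T), T)`. -/
def bracket (F : FormalGroup A) : ℕ → PowerSeries A
  | 0 => 0
  | m + 1 => F.toPowerSeries.subst ![F.bracket m, PowerSeries.X]

/-- An endomorphism of `F` over `A`: a power series `f(T)` with constant term `0` such that
`f(F(T₁, T₂)) = F(f(T₁), f(T₂))`. -/
@[ext]
structure Endo (F : FormalGroup A) where
  /-- The underlying power series. -/
  toSeries : PowerSeries A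
  constantCoeff_eq : PowerSeries.constantCoeff toSeries = 0
  map_law : toSeries.subst F.toPowerSeries = F.toPowerSeries.subst
    ![toSeries.subst (MvPowerSeries.X 0 : MvPowerSeries (Fin 2) A),
      toSeries.subst (MvPowerSeries.X 1 : MvPowerSeries (Fin 2) A)]

namespace Endo

variable {F : FormalGroup A}

theorem hasSubst (f : F.Endo) : PowerSeries.HasSubst f.toSeries :=
  PowerSeries.HasSubst.of_constantCoeff_zero' f.constantCoeff_eq

theorem hasSubst_law (F : FormalGroup A) : PowerSeries.HasSubst F.toPowerSeries :=
  PowerSeries.HasSubst.of_constantCoeff_zero F.zero_constantCoeff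

theorem constantCoeff_subst (f : F.Endo) {τ : Type*} {a : MvPowerSeries τ A}
    (ha : MvPowerSeries.constantCoeff a = 0) :
    MvPowerSeries.constantCoeff (f.toSeries.subst a) = 0 :=
  PowerSeries.constantCoeff_subst_eq_zero ha _ f.constantCoeff_eq

theorem map_law_apply (f : F.Endo) {a b : MvPowerSeries (Fin 2) A}
    (ha : MvPowerSeries.constantCoeff a = 0) (hb : MvPowerSeries.constantCoeff b = 0) :
    f.toSeries.subst (F.toPowerSeries.subst ![a, b]) =
      F.toPowerSeries.subst ![f.toSeries.subst a, f.toSeries.subst b] := by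
  have hab : MvPowerSeries.HasSubst ![a, b] :=
    MvPowerSeries.hasSubst_of_constantCoeff_zero fun s => by fin_cases s <;> simpa
  have h0 (i : Fin 2) : PowerSeries.HasSubst (MvPowerSeries.X i : MvPowerSeries (Fin 2) A) :=
    PowerSeries.HasSubst.of_constantCoeff_zero (by simp)
  have hf : MvPowerSeries.HasSubst
      ![f.toSeries.subst (MvPowerSeries.X 0 : MvPowerSeries (Fin 2) A),
        f.toSeries.subst (MvPowerSeries.X 1 : MvPowerSeries (Fin 2) A)] :=
    MvPowerSeries.hasSubst_of_constantCoeff_zero fun s => by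
      fin_cases s <;> exact f.constantCoeff_subst (by simp)
  have h := congrArg (MvPowerSeries.subst ![a, b]) f.map_law
  rw [PowerSeries.subst, MvPowerSeries.subst_comp_subst_apply (hasSubst_law F).const hab,
    MvPowerSeries.subst_comp_subst_apply hf hab] at h
  rw [PowerSeries.subst, h]
  congr 1
  funext s
  fin_cases s
  · simp [PowerSeries.subst, MvPowerSeries.subst_comp_subst_apply (h0 0).const hab,
      MvPowerSeries.subst_X hab]
  · simp [PowerSeries.subst, MvPowerSeries.subst_comp_subst_apply (h0 1).const hab,
      MvPowerSeries.subst_X hab]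

/-- The identity endomorphism `T`. -/
instance : One F.Endo where
  one :=
    { toSeries := PowerSeries.X
      constantCoeff_eq := PowerSeries.constantCoeff_X
      map_law := by
        have h0 (i : Fin 2) : PowerSeries.HasSubst (MvPowerSeries.X i : MvPowerSeries (Fin 2) A) :=
          PowerSeries.HasSubst.of_constantCoeff_zero (by simp)
        rw [PowerSeries.subst_X (hasSubst_law F), PowerSeries.subst_X (h0 0),
          PowerSeries.subst_X (h0 1)]
        conv_lhs => rw [← id_eq F.toPowerSeries, ← MvPowerSeries.subst_self]
        congr 1
        funext s
        fin_cases s <;> rfl }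

/-- Composition of endomorphisms: `(f * g)(T) = f(g(T))`. -/
instance : Mul F.Endo where
  mul f g :=
    { toSeries := f.toSeries.subst g.toSeries
      constantCoeff_eq := f.constantCoeff_subst g.constantCoeff_eq
      map_law := by
        have h0 (i : Fin 2) : PowerSeries.HasSubst (MvPowerSeries.X i : MvPowerSeries (Fin 2) A) :=
          PowerSeries.HasSubst.of_constantCoeff_zero (by simp)
        rw [PowerSeries.subst_comp_subst_apply g.hasSubst (hasSubst_law F), g.map_law,
          f.map_law_apply (g.constantCoeff_subst (by simp)) (g.constantCoeff_subst (by simp)),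
          PowerSeries.subst_comp_subst_apply g.hasSubst (h0 0),
          PowerSeries.subst_comp_subst_apply g.hasSubst (h0 1)] }

theorem one_toSeries : (1 : F.Endo).toSeries = PowerSeries.X := rfl

theorem mul_toSeries (f g : F.Endo) : (f * g).toSeries = f.toSeries.subst g.toSeries := rfl

instance : Monoid F.Endo where
  one_mul f := Endo.ext (PowerSeries.subst_X f.hasSubst)
  mul_one f := Endo.ext (PowerSeries.X_subst f.toSeries)
  mul_assoc f g k := Endo.ext (PowerSeries.subst_comp_subst_apply g.hasSubst k.hasSubst f.toSeries)

/-- Application of a ring homomorphism to the coefficients of an endomorphism. -/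
def map {G : FormalGroup B} (φ : A →+* B) (hG : F.map φ = G) : F.Endo →* G.Endo where
  toFun f :=
    { toSeries := PowerSeries.map φ f.toSeries
      constantCoeff_eq := by simp [← PowerSeries.coeff_zero_eq_constantCoeff_apply,
        PowerSeries.coeff_map, f.constantCoeff_eq]
      map_law := by
        subst hG
        have h0 (i : Fin 2) : PowerSeries.HasSubst (MvPowerSeries.X i : MvPowerSeries (Fin 2) A) :=
          PowerSeries.HasSubst.of_constantCoeff_zero (by simp)
        have hf : MvPowerSeries.HasSubst
            ![f.toSeries.subst (MvPowerSeries.X 0 : MvPowerSeries (Fin 2) A),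
              f.toSeries.subst (MvPowerSeries.X 1 : MvPowerSeries (Fin 2) A)] :=
          MvPowerSeries.hasSubst_of_constantCoeff_zero fun s => by
            fin_cases s <;> exact f.constantCoeff_subst (by simp)
        have h := congrArg (MvPowerSeries.map φ) f.map_law
        rw [PowerSeries.map_subst (hasSubst_law F), MvPowerSeries.map_subst hf] at h
        refine h.trans ?_
        rw [FormalGroup.map_toPowerSeries]
        congr 1
        funext s
        fin_cases s
        · simp [PowerSeries.map_subst (h0 0)]
        · simp [PowerSeries.map_subst (h0 1)] }
  map_one' := Endo.ext (PowerSeries.map_X φ)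
  map_mul' f g := Endo.ext (PowerSeries.map_subst g.hasSubst f.toSeries)

theorem map_toSeries {G : FormalGroup B} (φ : A →+* B) (hG : F.map φ = G) (f : F.Endo) :
    (Endo.map φ hG f).toSeries = PowerSeries.map φ f.toSeries := rfl

theorem coeff_mul_congr_left {f f' g : F.Endo} {i : ℕ}
    (h : ∀ k ≤ i, PowerSeries.coeff k f.toSeries = PowerSeries.coeff k f'.toSeries) :
    ∀ k ≤ i, PowerSeries.coeff k (f * g).toSeries = PowerSeries.coeff k (f' * g).toSeries := by
  intro k hk
  rw [mul_toSeries, mul_toSeries, PowerSeries.coeff_subst' g.hasSubst,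
    PowerSeries.coeff_subst' g.hasSubst]
  refine finsum_congr fun d => ?_
  rcases le_or_gt d i with hd | hd
  · rw [h d hd]
  · have h0 : PowerSeries.coeff k (g.toSeries ^ d) = 0 := by
      have hX : (PowerSeries.X : PowerSeries A) ∣ g.toSeries :=
        PowerSeries.X_dvd_iff.mpr g.constantCoeff_eq
      exact PowerSeries.X_pow_dvd_iff.mp (pow_dvd_pow_of_dvd hX d) k (by omega)
    rw [h0, smul_zero, smul_zero]

theorem coeff_mul_congr_right {f g g' : F.Endo} {i : ℕ}
    (h : ∀ k ≤ i, PowerSeries.coeff k g.toSeries = PowerSeries.coeff k g'.toSeries) :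
    ∀ k ≤ i, PowerSeries.coeff k (f * g).toSeries = PowerSeries.coeff k (f * g').toSeries := by
  intro k hk
  rw [mul_toSeries, mul_toSeries, PowerSeries.coeff_subst' g.hasSubst,
    PowerSeries.coeff_subst' g'.hasSubst]
  refine finsum_congr fun d => ?_
  have hX : (PowerSeries.X : PowerSeries A) ^ (i + 1) ∣ g.toSeries - g'.toSeries :=
    PowerSeries.X_pow_dvd_iff.mpr fun m hm => by rw [map_sub, h m (by omega), sub_self]
  have h1 := PowerSeries.X_pow_dvd_iff.mp (hX.trans (sub_dvd_pow_sub_pow _ _ d)) k (by omega)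
  rw [map_sub, sub_eq_zero] at h1
  rw [h1]

end Endo

/-- The group `Aut_A(F)` of automorphisms of `F` over `A`, under composition. -/
abbrev Auto (F : FormalGroup A) : Type _ := F.Endoˣ

/-- The subgroup of the `f ∈ Aut_A(F)` of the form `f(T) = T + a_{i+1} T^{i+1} + ⋯`; for `i = 0`
this is all of `Aut_A(F)`, see `autFil_zero`. -/
def autFil (F : FormalGroup A) (i : ℕ) : Subgroup F.Auto where
  carrier := {f | ∀ k ≤ i, PowerSeries.coeff k f.val.toSeries =
    PowerSeries.coeff k (PowerSeries.X : PowerSeries A)}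
  one_mem' := fun _ _ => rfl
  mul_mem' := by
    intro f g hf hg k hk
    have h := Endo.coeff_mul_congr_left (f := f.val) (f' := 1) (g := g.val) hf k hk
    rw [one_mul] at h
    exact h.trans (hg k hk)
  inv_mem' := by
    intro f hf k hk
    have h := Endo.coeff_mul_congr_left (f := f.val) (f' := 1) (g := f⁻¹.val) hf k hk
    rw [one_mul, Units.mul_inv] at h
    exact h.symm

theorem mem_autFil {F : FormalGroup A} {i : ℕ} {f : F.Auto} :
    f ∈ F.autFil i ↔ ∀ k ≤ i, PowerSeries.coeff k f.val.toSeries =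
      PowerSeries.coeff k (PowerSeries.X : PowerSeries A) := Iff.rfl

theorem autFil_zero (F : FormalGroup A) : F.autFil 0 = ⊤ := by
  refine (Subgroup.eq_top_iff' _).mpr fun f => mem_autFil.mpr fun k hk => ?_
  obtain rfl : k = 0 := by omega
  simp [f.val.constantCoeff_eq]

instance autFil_normal (F : FormalGroup A) (i : ℕ) : (F.autFil i).Normal where
  conj_mem := by
    intro f hf g k hk
    have h1 := Endo.coeff_mul_congr_right (f := g.val) (g := f.val) (g' := 1) hf
    have h2 := Endo.coeff_mul_congr_left (g := g⁻¹.val) h1 k hk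
    rw [mul_one, Units.mul_inv] at h2
    exact h2

/-- The successive quotient of the filtration `autFil F` in degree `i`. -/
abbrev autGr (F : FormalGroup A) (i : ℕ) : Type _ :=
  ↥(F.autFil i) ⧸ (F.autFil (i + 1)).subgroupOf (F.autFil i)

/-- Change of the coefficient ring on the subgroups `autFil`. -/
def autFilMap {F : FormalGroup A} {G : FormalGroup B} (φ : A →+* B) (hG : F.map φ = G) (i : ℕ) :
    F.autFil i →* G.autFil i :=
  ((Units.map (Endo.map φ hG)).comp (F.autFil i).subtype).codRestrict (G.autFil i) fun f k hk => by
    have h := congrArg φ (f.2 k hk)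
    rw [← PowerSeries.coeff_map, ← PowerSeries.coeff_map, PowerSeries.map_X] at h
    exact h

theorem coeff_autFilMap {F : FormalGroup A} {G : FormalGroup B} (φ : A →+* B)
    (hG : F.map φ = G) (i : ℕ) (f : F.autFil i) (k : ℕ) :
    PowerSeries.coeff k (autFilMap φ hG i f).val.val.toSeries =
      φ (PowerSeries.coeff k f.val.val.toSeries) :=
  PowerSeries.coeff_map φ k _

/-- Change of the coefficient ring on the successive quotients. -/
def autGrMap {F : FormalGroup A} {G : FormalGroup B} (φ : A →+* B) (hG : F.map φ = G) (i : ℕ) :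
    F.autGr i →* G.autGr i :=
  QuotientGroup.map _ _ (autFilMap φ hG i) fun f hf =>
    (autFilMap φ hG (i + 1) ⟨f.val, hf⟩).2

theorem autGrMap_mk {F : FormalGroup A} {G : FormalGroup B} (φ : A →+* B) (hG : F.map φ = G)
    (i : ℕ) (f : F.autFil i) :
    autGrMap φ hG i (QuotientGroup.mk f) = QuotientGroup.mk (autFilMap φ hG i f) := rfl

theorem autFil_ext {F : FormalGroup A} {i : ℕ} {f g : F.autFil i}
    (h : ∀ k, PowerSeries.coeff k f.val.val.toSeries = PowerSeries.coeff k g.val.val.toSeries) :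
    f = g :=
  Subtype.ext (Units.ext (Endo.ext (PowerSeries.ext h)))

end Ring

end FormalGroup

/-- The additive group of the elements of `A` that are fixed by the `p^h`-th power map, where `A`
is a ring in which `p = 0`. -/
def frobFixed (p h : ℕ) [Fact p.Prime] (A : Type*) [CommRing A] (hA : (p : A) = 0) :
    AddSubgroup A where
  carrier := {a | a ^ p ^ h = a}
  zero_mem' := zero_pow (pow_ne_zero _ (Fact.out : p.Prime).ne_zero)
  add_mem' := by
    intro a b ha hb
    have h1 := add_pow_prime_pow_eq (Fact.out : p.Prime) a b h
    rw [hA, zero_mul, zero_mul, zero_mul, add_zero] at h1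
    exact h1.trans (congrArg₂ (· + ·) ha hb)
  neg_mem' := by
    intro a ha
    have h1 := add_pow_prime_pow_eq (Fact.out : p.Prime) a (-a) h
    rw [hA, zero_mul, zero_mul, zero_mul, add_zero, add_neg_cancel,
      zero_pow (pow_ne_zero _ (Fact.out : p.Prime).ne_zero), show a ^ p ^ h = a from ha] at h1
    exact (neg_eq_of_add_eq_zero_right h1.symm).symm

namespace AutH

section

variable (p : ℕ)

/-- The scheme `Spec 𝔽_p`. -/
abbrev baseScheme : Scheme.{u} := Spec (CommRingCat.of (ULift.{u} (ZMod p)))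

variable {p}

/-- The ring `Γ(S) = Γ(S, 𝒪_S)` of an `𝔽_p`-scheme `S`. -/
abbrev glob (S : Over (baseScheme.{u} p)) : CommRingCat.{u} := Γ(S.left, ⊤)

/-- The structure map `𝔽_p → Γ(S)`. -/
def structMap (S : Over (baseScheme.{u} p)) : ZMod p →+* glob S :=
  ((Scheme.ΓSpecIso _).inv ≫ S.hom.appTop).hom.comp
    (ULift.ringEquiv (R := ZMod p)).symm.toRingHom

/-- Pullback of functions along a morphism of `𝔽_p`-schemes. -/
abbrev globMap {S S' : Over (baseScheme.{u} p)} (g : S' ⟶ S) : glob S →+* glob S' :=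
  g.left.appTop.hom

theorem natCast_glob (S : Over (baseScheme.{u} p)) : (p : glob S) = 0 := by
  rw [← map_natCast (structMap S), CharP.cast_eq_zero, map_zero]

theorem globMap_id (S : Over (baseScheme.{u} p)) : globMap (𝟙 S) = RingHom.id (glob S) := by
  simp [globMap]

theorem globMap_comp {S S' S'' : Over (baseScheme.{u} p)} (g : S' ⟶ S) (g' : S'' ⟶ S') :
    globMap (g' ≫ g) = (globMap g').comp (globMap g) := by
  rw [← CommRingCat.hom_comp, ← Scheme.Hom.comp_appTop, ← Over.comp_left]

/-- The formal group law `H`, viewed as defined over `Γ(S)`. -/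
def lawOver (H : FormalGroup (ZMod p)) (S : Over (baseScheme.{u} p)) : FormalGroup (glob S) :=
  H.map (structMap S)

theorem lawOver_map (H : FormalGroup (ZMod p)) {S S' : Over (baseScheme.{u} p)} (g : S' ⟶ S) :
    (lawOver H S).map (globMap g) = lawOver H S' := by
  have h : (globMap g).comp (structMap S) = structMap S' := RingHom.ext_zmod _ _
  refine FormalGroup.ext ?_
  ext n
  simp [lawOver, ← h]

/-- The presheaf of groups `A_i^H` on `𝔽_p`-schemes. -/
def filPresheaf (H : FormalGroup (ZMod p)) (i : ℕ) :
    (Over (baseScheme.{u} p))ᵒᵖ ⥤ GrpCat.{u} where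
  obj S := GrpCat.of ((lawOver H S.unop).autFil i)
  map g := GrpCat.ofHom (FormalGroup.autFilMap (globMap g.unop) (lawOver_map H g.unop) i)
  map_id S := by
    refine GrpCat.hom_ext (MonoidHom.ext fun f => FormalGroup.autFil_ext fun k => ?_)
    exact (FormalGroup.coeff_autFilMap _ _ _ _ _).trans (RingHom.congr_fun (globMap_id S.unop) _)
  map_comp g g' := by
    refine GrpCat.hom_ext (MonoidHom.ext fun f => FormalGroup.autFil_ext fun k => ?_)
    refine (FormalGroup.coeff_autFilMap _ _ _ _ _).trans
      ((RingHom.congr_fun (globMap_comp g.unop g'.unop) _).trans ?_)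
    refine Eq.trans ?_ (FormalGroup.coeff_autFilMap _ _ _ _ _).symm
    exact congrArg (globMap g'.unop) (FormalGroup.coeff_autFilMap _ _ _ _ _).symm

/-- The quotient presheaf of groups `A_i^H / A_{i+1}^H` on `𝔽_p`-schemes,
`S ↦ A_i^H(S) / A_{i+1}^H(S)`. -/
def grPresheaf (H : FormalGroup (ZMod p)) (i : ℕ) :
    (Over (baseScheme.{u} p))ᵒᵖ ⥤ GrpCat.{u} where
  obj S := GrpCat.of ((lawOver H S.unop).autGr i)
  map g := GrpCat.ofHom (FormalGroup.autGrMap (globMap g.unop) (lawOver_map H g.unop) i)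
  map_id S := by
    refine GrpCat.hom_ext (MonoidHom.ext fun x => ?_)
    obtain ⟨f, rfl⟩ := QuotientGroup.mk_surjective x
    exact congrArg QuotientGroup.mk (ConcreteCategory.congr_hom ((filPresheaf H i).map_id S) f)
  map_comp g g' := by
    refine GrpCat.hom_ext (MonoidHom.ext fun x => ?_)
    obtain ⟨f, rfl⟩ := QuotientGroup.mk_surjective x
    exact congrArg QuotientGroup.mk
      (ConcreteCategory.congr_hom ((filPresheaf H i).map_comp g g') f)

variable (p)

/-- The presheaf of groups `μ_n` on `𝔽_p`-schemes, `S ↦ {a ∈ Γ(S)ˣ | a ^ n = 1}`. -/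
def muPresheaf (n : ℕ) : (Over (baseScheme.{u} p))ᵒᵖ ⥤ GrpCat.{u} where
  obj S := GrpCat.of (rootsOfUnity n (glob S.unop))
  map g := GrpCat.ofHom (restrictRootsOfUnity (globMap g.unop) n)
  map_id S := by
    refine GrpCat.hom_ext (MonoidHom.ext fun a => Subtype.ext (Units.ext ?_))
    exact RingHom.congr_fun (globMap_id S.unop) a.val.val
  map_comp g g' := by
    refine GrpCat.hom_ext (MonoidHom.ext fun a => Subtype.ext (Units.ext ?_))
    exact RingHom.congr_fun (globMap_comp g.unop g'.unop) a.val.val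

/-- The presheaf of groups of `p^h`-Frobenius fixed points of the additive group `𝔾_a` on
`𝔽_p`-schemes, `S ↦ {a ∈ Γ(S) | a ^ (p ^ h) = a}`, with addition as group law. -/
def gaFrobPresheaf (h : ℕ) [Fact p.Prime] : (Over (baseScheme.{u} p))ᵒᵖ ⥤ GrpCat.{u} where
  obj S := GrpCat.of (Multiplicative (frobFixed p h (glob S.unop) (natCast_glob S.unop)))
  map g := GrpCat.ofHom (AddMonoidHom.toMultiplicative
    (((globMap g.unop).toAddMonoidHom.comp (AddSubgroup.subtype _)).codRestrict
      (frobFixed p h _ (natCast_glob _)) fun a =>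
        (map_pow (globMap g.unop) _ _).symm.trans (congrArg (globMap g.unop) a.2)))
  map_id S := by
    refine GrpCat.hom_ext (MonoidHom.ext fun a => ?_)
    refine Multiplicative.toAdd.injective (Subtype.ext ?_)
    exact RingHom.congr_fun (globMap_id S.unop) a.toAdd.val
  map_comp g g' := by
    refine GrpCat.hom_ext (MonoidHom.ext fun a => ?_)
    refine Multiplicative.toAdd.injective (Subtype.ext ?_)
    exact RingHom.congr_fun (globMap_comp g.unop g'.unop) a.toAdd.val

end

end AutH

end

/-! Write q = p^h and let `A` be the ring of functions. An endomorphism f commutes with [p](T) =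
T^q, so f(T^q) = f(T)^q. Since p = 0 in `A`, comparing coefficients gives a^q = a for every
coefficient of f (`Endo.coeff_pow_eq`). The leading coefficient is multiplicative in degree one and
additive on the deeper steps of the filtration. It therefore maps into the stated groups, and its
kernel is the next step by definition. Outside powers of p there is nothing: if f = T + aT^n + ⋯,
then a((x+y)^n - x^n - y^n) = 0, and some intermediate binomial coefficient is a unit in `A` unless
n is a power of p.

The substance is surjectivity. The law has coefficients in the prime field, so the problem descends
to the subring of elements with a^q = a. Over that subring every series without constant term
commutes with T^q = [p](T). Suppose the defect f(F(x,y)) - F(f(x),f(y)) has no terms below degree n.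
Its part D in degree n is then a symmetric additive 2-cocycle, and f∘[p] - [p]∘f has leading term
(∑_{r<p} D(r,1)) T^n (`X_pow_dvd_subst_bracket_sub`). That sum is thus zero, which removes the one
obstruction to D being a coboundary, namely Lazard's cocycle ((x+y)^n - x^n - y^n)/p
(`exists_eq_mul_choose_of_symmetric_cocycle`). A correction of f by a monomial cT^n raises the order
of the defect, and iterating converges to an endomorphism (`exists_endo_of_vanishesBelow`). The
starting points are aT and T + aT^(p^j). An endomorphism with unit linear coefficient is an
automorphism. -/

/-! ### Arithmetic modulo p and symmetric additive 2-cocycles -/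

theorem natCast_eq_natCast_of_modEq {A : Type*} [CommRing A] {p : ℕ} (hA : (p : A) = 0) {a b : ℕ}
    (h : a ≡ b [MOD p]) : (a : A) = b := by
  obtain ⟨c, hc⟩ := (Nat.modEq_iff_dvd.mp h)
  have := congrArg (Int.cast : ℤ → A) hc
  push_cast at this
  rw [hA, zero_mul, sub_eq_zero] at this
  exact this.symm

theorem isUnit_natCast_of_not_dvd {A : Type*} [CommRing A] {p : ℕ} [Fact p.Prime]
    (hA : (p : A) = 0) {n : ℕ} (h : ¬ p ∣ n) : IsUnit (n : A) := by
  have h1 : IsCoprime (n : ℤ) (p : ℤ) :=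
    Nat.isCoprime_iff_coprime.mpr (((Fact.out : p.Prime).coprime_iff_not_dvd.mpr h).symm)
  have h2 := h1.map (Int.castRingHom A)
  simpa [hA, isCoprime_zero_right] using h2

theorem natCast_pow_prime {A : Type*} [CommRing A] {p : ℕ} [Fact p.Prime]
    (hA : (p : A) = 0) (m : ℕ) : (m : A) ^ p = m := by
  have h : m ^ p ≡ m [MOD p] := by
    rw [← ZMod.natCast_eq_natCast_iff]
    push_cast
    exact ZMod.pow_card _
  simpa using natCast_eq_natCast_of_modEq hA h

/-- The power sum is computed in `ZMod p` and carried to `A` as a congruence of natural numbers. In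
degree p it isolates the coefficient with index p - 1 in the obstruction sum. -/
theorem sum_range_natCast_pow {A : Type*} [CommRing A] {p : ℕ} [Fact p.Prime]
    (hA : (p : A) = 0) {i : ℕ} (hi : i < p) (hi0 : i ≠ 0) :
    ∑ m ∈ Finset.range p, (m : A) ^ i = if i = p - 1 then -1 else 0 := by
  have key : ∑ m ∈ Finset.range p, (m : ZMod p) ^ i = if i = p - 1 then -1 else 0 := by
    have e : ∑ m ∈ Finset.range p, (m : ZMod p) ^ i = ∑ x : ZMod p, x ^ i := by
      refine Finset.sum_bij' (fun m _ => (m : ZMod p)) (fun x _ => x.val) ?_ ?_ ?_ ?_ ?_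
      · simp
      · intro x _; simpa using ZMod.val_lt x
      · intro m hm; exact ZMod.val_cast_of_lt (by simpa using hm)
      · intro x _; simp
      · simp
    rw [e]
    split_ifs with h
    · have h1 := FiniteField.sum_pow_units (ZMod p) i
      rw [← Finset.sum_subset (Finset.subset_univ (Finset.univ.image
        (Units.val : (ZMod p)ˣ → ZMod p))) ?_, Finset.sum_image (fun _ _ _ _ h => Units.ext h)]
      · rw [h1, if_pos (by rw [ZMod.card, h])]
      · intro x _ hx
        have : x = 0 := by
          by_contra h0
          exact hx (Finset.mem_image.mpr ⟨Units.mk0 x h0, Finset.mem_univ _, rfl⟩)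
        rw [this, zero_pow hi0]
    · exact FiniteField.sum_pow_lt_card_sub_one (ZMod p) i (by rw [ZMod.card]; omega)
  have hp := (Fact.out : p.Prime).one_lt
  split_ifs at key ⊢ with h
  · have h2 : (∑ m ∈ Finset.range p, m ^ i + 1) ≡ 0 [MOD p] := by
      rw [← ZMod.natCast_eq_natCast_iff]
      push_cast
      rw [key]; ring
    have := natCast_eq_natCast_of_modEq hA h2
    push_cast at this
    exact eq_neg_of_add_eq_zero_left this
  · have h2 : (∑ m ∈ Finset.range p, m ^ i) ≡ 0 [MOD p] := by
      rw [← ZMod.natCast_eq_natCast_iff]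
      push_cast
      rw [key]
    simpa using natCast_eq_natCast_of_modEq hA h2

/-- A symmetric additive `2`-cocycle of degree `n` in characteristic `p`, given by its coefficients
`γ`, is a coboundary as soon as the sum of its values at `(m, 1)` for `m < p` vanishes. -/
theorem exists_eq_mul_choose_of_symmetric_cocycle {A : Type*} [CommRing A] {p : ℕ} [Fact p.Prime]
    (hA : (p : A) = 0) (n : ℕ) (γ : ℕ → A) (hsymm : ∀ i, 0 < i → i < n → γ (n - i) = γ i)
    (hcoc : ∀ i j k, 0 < i → 0 < j → 0 < k → i + j + k = n →
      ((i + j).choose i : A) * γ (i + j) = ((j + k).choose j : A) * γ i)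
    (hsum : ∑ m ∈ Finset.range p, ∑ i ∈ Finset.Ioo 0 n, γ i * (m : A) ^ i = 0) :
    ∃ c : A, ∀ i, 0 < i → i < n → γ i = c * (n.choose i : A) := by
  have hp := (Fact.out : p.Prime)
  induction n using Nat.strong_induction_on generalizing γ with
  | _ n ih =>
  -- The cocycle relation at (1, i - 1, n - i): the coefficient with index 1 controls all those
  -- whose index is prime to p.
  have hP : ∀ i, 0 < i → i < n → (i : A) * γ i = γ 1 * ((n - 1).choose (i - 1) : A) := by
    intro i hi hin
    rcases Nat.lt_or_ge 1 i with h1 | h1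
    · have := hcoc 1 (i - 1) (n - i) one_pos (by omega) (by omega) (by omega)
      rw [show 1 + (i - 1) = i by omega, show i - 1 + (n - i) = n - 1 by omega,
        Nat.choose_one_right] at this
      rw [this, mul_comm]
    · obtain rfl : i = 1 := by omega
      simp
  have hz : γ 1 = 0 → ∀ i, 0 < i → i < n → ¬ p ∣ i → γ i = 0 := by
    intro h1 i hi hin hpi
    have := hP i hi hin
    rw [h1, zero_mul] at this
    exact (isUnit_natCast_of_not_dvd hA hpi).mul_right_eq_zero.mp this
  by_cases hpn : p ∣ n
  · obtain ⟨n', rfl⟩ := hpn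
    rcases Nat.lt_trichotomy n' 1 with hn' | rfl | hn'
    · obtain rfl : n' = 0 := by omega
      exact ⟨0, fun i hi hin => by omega⟩
    -- Degree p, the only place where the cocycle relations leave `γ 1` free. The hypothesis `hsum`
    -- reduces to -γ(p - 1) = 0, which is γ 1 = 0 by symmetry.
    · rw [mul_one] at *
      have h1 : γ 1 = 0 := by
        rw [Finset.sum_comm, Finset.sum_eq_single (p - 1)] at hsum
        · rw [← Finset.mul_sum, sum_range_natCast_pow hA (by have := hp.pos; omega)
            (by have := hp.one_lt; omega), if_pos rfl, hsymm 1 one_pos hp.one_lt] at hsum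
          simpa using hsum
        · intro i hi hne
          rw [Finset.mem_Ioo] at hi
          rw [← Finset.mul_sum, sum_range_natCast_pow hA hi.2 (by omega), if_neg hne, mul_zero]
        · intro h
          exact absurd (Finset.mem_Ioo.mpr ⟨by have := hp.one_lt; omega,
            by have := hp.one_lt; omega⟩) h
      exact ⟨0, fun i hi hin => by
        rw [hz h1 i hi hin (fun h => absurd (Nat.le_of_dvd hi h) (by omega)), zero_mul]⟩
    · have hpp : p * n' ≥ p * 2 := Nat.mul_le_mul_left p hn'
      have hp1 := hp.one_lt
      have h1 : γ 1 = 0 := by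
        -- The relation at (1, p - 1, n - p) has coefficient p = 0 on one side and, by Lucas, a
        -- binomial coefficient congruent to 1 on the other.
        have h := hcoc 1 (p - 1) (p * n' - p) one_pos (by omega) (by omega) (by omega)
        rw [show 1 + (p - 1) = p by omega, Nat.choose_one_right, hA, zero_mul,
          show p - 1 + (p * n' - p) = p * n' - 1 by omega] at h
        have hmod : (p * n' - 1).choose (p - 1) ≡ 1 [MOD p] := by
          have hL := Choose.choose_modEq_choose_mod_mul_choose_div_nat
            (n := p * n' - 1) (k := p - 1) (p := p)
          have e1 : (p * n' - 1) % p = p - 1 := by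
            have : p * n' - 1 = (p - 1) + p * (n' - 1) := by
              obtain ⟨t, rfl⟩ : ∃ t, n' = t + 1 := ⟨n' - 1, by omega⟩
              simp only [Nat.add_sub_cancel, mul_add, mul_one]
              omega
            rw [this, Nat.add_mul_mod_self_left, Nat.mod_eq_of_lt (by omega)]
          rw [e1, Nat.mod_eq_of_lt (by omega : p - 1 < p), Nat.choose_self,
            Nat.div_eq_of_lt (by omega : p - 1 < p), Nat.choose_zero_right] at hL
          exact hL
        rw [natCast_eq_natCast_of_modEq hA hmod] at h
        simpa using h.symm
      have hn'lt : n' < p * n' := by nlinarith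
      -- Only indices divisible by p survive, so the cocycle is one of degree n' in x^p and y^p. The
      -- binomial coefficients are unchanged modulo p when both entries are divided by p, and `hsum`
      -- descends because m^p = m in `A`.
      obtain ⟨c, hc⟩ := ih n' hn'lt (fun i => γ (p * i))
        (fun i hi hin => by
          have := hsymm (p * i) (by positivity) (Nat.mul_lt_mul_of_pos_left hin hp.pos)
          rwa [← Nat.mul_sub] at this)
        (fun i j k hi hj hk hijk => by
          have := hcoc (p * i) (p * j) (p * k) (by positivity) (by positivity) (by positivity)
            (by rw [← hijk]; ring)
          rw [← mul_add, ← mul_add, natCast_eq_natCast_of_modEq hA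
            Choose.choose_mul_mul_modEq_choose_nat, natCast_eq_natCast_of_modEq hA
            Choose.choose_mul_mul_modEq_choose_nat] at this
          exact this)
        (by
          rw [← hsum]
          refine Finset.sum_congr rfl fun m _ => ?_
          have hinj : Set.InjOn (fun i => p * i) (Finset.Ioo 0 n' : Set ℕ) :=
            fun a _ b _ h => Nat.eq_of_mul_eq_mul_left hp.pos h
          rw [← Finset.sum_subset (s₁ := (Finset.Ioo 0 n').image (fun i => p * i))
            (s₂ := Finset.Ioo 0 (p * n')),
            Finset.sum_image hinj]
          · refine Finset.sum_congr rfl fun i _ => ?_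
            rw [pow_mul, natCast_pow_prime hA]
          · intro x hx
            obtain ⟨i, hi, rfl⟩ := Finset.mem_image.mp hx
            rw [Finset.mem_Ioo] at hi ⊢
            exact ⟨Nat.mul_pos hp.pos hi.1, Nat.mul_lt_mul_of_pos_left hi.2 hp.pos⟩
          · intro x hx hx'
            rw [Finset.mem_Ioo] at hx
            rw [hz h1 x hx.1 hx.2, zero_mul]
            rintro ⟨i, rfl⟩
            exact hx' (Finset.mem_image.mpr ⟨i, Finset.mem_Ioo.mpr
              ⟨Nat.pos_of_mul_pos_left hx.1, Nat.lt_of_mul_lt_mul_left hx.2⟩, rfl⟩))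
      refine ⟨c, fun i hi hin => ?_⟩
      by_cases hpi : p ∣ i
      · obtain ⟨i, rfl⟩ := hpi
        rw [natCast_eq_natCast_of_modEq hA Choose.choose_mul_mul_modEq_choose_nat]
        exact hc i (Nat.pos_of_mul_pos_left hi) (Nat.lt_of_mul_lt_mul_left hin)
      -- For i prime to p the binomial coefficient vanishes too, since i·C(n, i) = n·C(n - 1, i - 1)
      -- and p divides n.
      · rw [hz h1 i hi hin hpi]
        refine ((isUnit_natCast_of_not_dvd hA hpi).mul_right_eq_zero.mp ?_).symm
        obtain ⟨i, rfl⟩ : ∃ t, i = t + 1 := ⟨i - 1, by omega⟩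
        obtain ⟨N, hN⟩ : ∃ t, p * n' = t + 1 := ⟨p * n' - 1, by omega⟩
        have h := congrArg (Nat.cast : ℕ → A) (Nat.add_one_mul_choose_eq N i)
        rw [← hN] at h
        push_cast at h
        rw [hA] at h
        push_cast
        linear_combination (-c) * h
  · obtain ⟨v, hv⟩ := (isUnit_natCast_of_not_dvd hA hpn).exists_left_inv
    have hreg : ∀ i, 0 < i → i < n → ¬ p ∣ i → γ i = γ 1 * v * (n.choose i : A) := by
      intro i hi hin hpi
      refine (isUnit_natCast_of_not_dvd hA hpi).mul_left_cancel ?_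
      have h1 := hP i hi hin
      obtain ⟨i, rfl⟩ : ∃ t, i = t + 1 := ⟨i - 1, by omega⟩
      obtain ⟨N, rfl⟩ : ∃ t, n = t + 1 := ⟨n - 1, by omega⟩
      have h := congrArg (Nat.cast : ℕ → A) (Nat.add_one_mul_choose_eq N i)
      rw [h1]
      simp only [Nat.add_sub_cancel]
      push_cast at h hv ⊢
      linear_combination (-γ 1 * (N.choose i : A)) * hv + γ 1 * v * h
    refine ⟨γ 1 * v, fun i hi hin => ?_⟩
    by_cases hpi : p ∣ i
    -- When p divides i but not n, the complementary index n - i is prime to p.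
    · rw [← hsymm i hi hin, ← Nat.choose_symm hin.le]
      exact hreg _ (by omega) (by omega) fun h => hpn ((Nat.dvd_sub_iff_left hin.le hpi).mp h)
    · exact hreg i hi hin hpi

noncomputable section

/-! ### Substitution of curves into series in two variables -/

section Curves

open PowerSeries

variable {A B : Type*} [CommRing A] [CommRing B] [Algebra A B]

theorem PowerSeries.hasSubst_of_X_dvd {u : B⟦X⟧} (hu : X ∣ u) : PowerSeries.HasSubst u :=
  HasSubst.of_constantCoeff_zero' (X_dvd_iff.mp hu)

theorem PowerSeries.hasSubst_pair {u v : B⟦X⟧} (hu : X ∣ u) (hv : X ∣ v) :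
    MvPowerSeries.HasSubst ![u, v] :=
  MvPowerSeries.hasSubst_of_constantCoeff_zero fun s => by
    fin_cases s
    · exact X_dvd_iff.mp hu
    · exact X_dvd_iff.mp hv

theorem PowerSeries.coeff_subst_pair {u v : B⟦X⟧} (hu : X ∣ u) (hv : X ∣ v)
    (D : MvPowerSeries (Fin 2) A) (k : ℕ) :
    coeff k (D.subst ![u, v] : B⟦X⟧) =
      ∑ᶠ d : Fin 2 →₀ ℕ, MvPowerSeries.coeff d D • coeff k (u ^ d 0 * v ^ d 1) := by
  rw [PowerSeries.coeff, MvPowerSeries.coeff_subst (hasSubst_pair hu hv)]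
  refine finsum_congr fun d => ?_
  rw [Finsupp.prod_fintype _ _ (by simp), Fin.prod_univ_two]
  rfl

theorem PowerSeries.zero_subst_pair {u v : B⟦X⟧} (hu : X ∣ u) (hv : X ∣ v) :
    (MvPowerSeries.subst ![u, v] (0 : MvPowerSeries (Fin 2) A) : B⟦X⟧) = 0 := by
  rw [← MvPowerSeries.coe_substAlgHom (hasSubst_pair hu hv)]
  exact map_zero _

theorem PowerSeries.X_dvd_subst_pair {u v : B⟦X⟧} (hu : X ∣ u) (hv : X ∣ v)
    {D : MvPowerSeries (Fin 2) A} (hD : MvPowerSeries.constantCoeff D = 0) :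
    X ∣ (D.subst ![u, v] : B⟦X⟧) := by
  refine X_dvd_iff.mpr (MvPowerSeries.constantCoeff_subst_eq_zero (hasSubst_pair hu hv) ?_ hD)
  intro s
  fin_cases s
  · exact X_dvd_iff.mp hu
  · exact X_dvd_iff.mp hv

theorem PowerSeries.X_dvd_subst {f : A⟦X⟧} (hf : X ∣ f) {u : B⟦X⟧} (hu : X ∣ u) :
    X ∣ (f.subst u : B⟦X⟧) :=
  X_dvd_iff.mpr (PowerSeries.constantCoeff_subst_eq_zero (X_dvd_iff.mp hu) _ (X_dvd_iff.mp hf))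

/-- The series `D` has no terms of total degree less than `m`. -/
def MvPowerSeries.VanishesBelow (D : MvPowerSeries (Fin 2) A) (m : ℕ) : Prop :=
  ∀ d : Fin 2 →₀ ℕ, d 0 + d 1 < m → MvPowerSeries.coeff d D = 0

/-- Each of the i + j ≥ m factors contributes a factor `X`; the cofactors still agree modulo `X ^
N`. -/
theorem PowerSeries.X_pow_dvd_mul_pow_sub {m N i j : ℕ} (hij : m ≤ i + j) {u v u' v' : B⟦X⟧}
    (hu : X ∣ u) (hv : X ∣ v) (hu' : X ^ (N + 1) ∣ u - u') (hv' : X ^ (N + 1) ∣ v - v') :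
    X ^ (m + N) ∣ u ^ i * v ^ j - u' ^ i * v' ^ j := by
  obtain ⟨U, rfl⟩ := hu
  obtain ⟨V, rfl⟩ := hv
  obtain ⟨W, hW⟩ := hu'
  obtain ⟨Z, hZ⟩ := hv'
  obtain rfl : u' = X * (U - X ^ N * W) := by linear_combination -hW
  obtain rfl : v' = X * (V - X ^ N * Z) := by linear_combination -hZ
  have h1 : (X : B⟦X⟧) ^ N ∣ U ^ i * V ^ j - (U - X ^ N * W) ^ i * (V - X ^ N * Z) ^ j := by
    rw [← Ideal.mem_span_singleton, ← Ideal.Quotient.mk_eq_mk_iff_sub_mem]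
    have h0 : Ideal.Quotient.mk (Ideal.span {(X : B⟦X⟧) ^ N}) (X ^ N) = 0 :=
      Ideal.Quotient.eq_zero_iff_mem.mpr (Ideal.mem_span_singleton_self _)
    rw [map_mul, map_mul, map_pow, map_pow, map_pow, map_pow, map_sub, map_sub, map_mul, map_mul,
      h0, zero_mul, zero_mul, sub_zero, sub_zero]
  rw [mul_pow, mul_pow, mul_pow, mul_pow, show ∀ a b c d e f : B⟦X⟧,
    a * b * (c * d) - a * e * (c * f) = (a * c) * (b * d - e * f) by intros; ring, ← pow_add,
    pow_add X m N]
  exact mul_dvd_mul (pow_dvd_pow X hij) h1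

/-- The basic approximation tool: a series of order m gains m - 1 in precision, monomial by
monomial. With N = 1 it allows F(u,v) to be replaced by u + v, and [m](T) by mT, inside the lowest
part of a defect. -/
theorem MvPowerSeries.VanishesBelow.X_pow_dvd_subst_sub {D : MvPowerSeries (Fin 2) A} {m N : ℕ}
    (hD : D.VanishesBelow m) {u v u' v' : B⟦X⟧} (hu : PowerSeries.X ∣ u) (hv : PowerSeries.X ∣ v)
    (hu' : PowerSeries.X ^ (N + 1) ∣ u - u') (hv' : PowerSeries.X ^ (N + 1) ∣ v - v') :
    PowerSeries.X ^ (m + N) ∣ (D.subst ![u, v] - D.subst ![u', v'] : B⟦X⟧) := by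
  have hXu : PowerSeries.X ∣ u' := (dvd_sub_right hu).mp ((dvd_pow_self PowerSeries.X N.succ_ne_zero).trans hu')
  have hXv : PowerSeries.X ∣ v' := (dvd_sub_right hv).mp ((dvd_pow_self PowerSeries.X N.succ_ne_zero).trans hv')
  refine PowerSeries.X_pow_dvd_iff.mpr fun k hk => ?_
  rw [map_sub, sub_eq_zero, coeff_subst_pair hu hv, coeff_subst_pair hXu hXv]
  refine finsum_congr fun d => ?_
  rcases Nat.lt_or_ge (d 0 + d 1) m with h | h
  · rw [hD d h, zero_smul, zero_smul]
  · have := PowerSeries.X_pow_dvd_iff.mp (X_pow_dvd_mul_pow_sub h hu hv hu' hv') k hk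
    rw [map_sub, sub_eq_zero] at this
    rw [this]

theorem MvPowerSeries.VanishesBelow.X_pow_dvd_subst {D : MvPowerSeries (Fin 2) A} {m : ℕ}
    (hD : D.VanishesBelow m) {u v : B⟦X⟧} (hu : PowerSeries.X ∣ u) (hv : PowerSeries.X ∣ v) :
    PowerSeries.X ^ m ∣ (D.subst ![u, v] : B⟦X⟧) := by
  refine PowerSeries.X_pow_dvd_iff.mpr fun k hk => ?_
  rw [coeff_subst_pair hu hv]
  refine finsum_eq_zero_of_forall_eq_zero fun d => ?_
  rcases Nat.lt_or_ge (d 0 + d 1) m with h | h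
  · rw [hD d h, zero_smul]
  · have h1 : PowerSeries.X ^ m ∣ u ^ d 0 * v ^ d 1 :=
      (pow_dvd_pow PowerSeries.X h).trans (pow_add (PowerSeries.X : B⟦X⟧) _ _ ▸
        mul_dvd_mul (pow_dvd_pow_of_dvd hu _) (pow_dvd_pow_of_dvd hv _))
    rw [PowerSeries.X_pow_dvd_iff.mp h1 k hk, smul_zero]

/-- The exponent `(i, j)` of a monomial in two variables. -/
def expPair (i j : ℕ) : Fin 2 →₀ ℕ := Finsupp.equivFunOnFinite.symm ![i, j]

theorem expPair_surjective (d : Fin 2 →₀ ℕ) : expPair (d 0) (d 1) = d := by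
  ext s
  fin_cases s <;> rfl

/-- The value at `(x, y)` of the homogeneous part of degree `n` of the series `D`. -/
def MvPowerSeries.homogEval (D : MvPowerSeries (Fin 2) A) (n : ℕ) (x y : B) : B :=
  ∑ l ∈ Finset.range (n + 1), MvPowerSeries.coeff (expPair l (n - l)) D • (x ^ l * y ^ (n - l))

theorem coeff_subst_linear (D : MvPowerSeries (Fin 2) A) (x y : B) (n : ℕ) :
    coeff n (D.subst ![C x * X, C y * X] : B⟦X⟧) = D.homogEval n x y := by
  rw [MvPowerSeries.homogEval, coeff_subst_pair (dvd_mul_left X _) (dvd_mul_left X _)]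
  have key (d : Fin 2 →₀ ℕ) : coeff n ((C x * X) ^ d 0 * (C y * X) ^ d 1 : B⟦X⟧) =
      if n = d 0 + d 1 then x ^ d 0 * y ^ d 1 else 0 := by
    rw [show ((C x * X) ^ d 0 * (C y * X) ^ d 1 : B⟦X⟧) =
      C (x ^ d 0 * y ^ d 1) * X ^ (d 0 + d 1) by
        rw [map_mul, map_pow, map_pow]; ring, coeff_C_mul, coeff_X_pow, mul_ite, mul_one, mul_zero]
  have hinj : Set.InjOn (fun l => expPair l (n - l)) (Finset.range (n + 1) : Set ℕ) :=
    fun a _ b _ h => DFunLike.congr_fun h (0 : Fin 2)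
  rw [finsum_eq_sum_of_support_subset (s := (Finset.range (n + 1)).image
    (fun l => expPair l (n - l)))]
  · rw [Finset.sum_image hinj]
    refine Finset.sum_congr rfl fun l hl => ?_
    rw [Finset.mem_range] at hl
    rw [key, if_pos]
    · rfl
    · change n = l + (n - l)
      omega
  · intro d hd
    rw [Function.mem_support, key] at hd
    have h : n = d 0 + d 1 := by
      by_contra h
      rw [if_neg h, smul_zero] at hd
      exact hd rfl
    refine Finset.mem_coe.mpr (Finset.mem_image.mpr ⟨d 0, Finset.mem_range.mpr (by omega), ?_⟩)
    rw [show n - d 0 = d 1 by omega, expPair_surjective]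

open Polynomial in
/-- Total degrees can be tested on the curve `(xT, T)` over the polynomial ring in `x`. -/
theorem MvPowerSeries.vanishesBelow_of_curve {D : MvPowerSeries (Fin 2) A} {m : ℕ}
    (h : (PowerSeries.X : A[X]⟦X⟧) ^ m ∣ D.subst ![PowerSeries.C Polynomial.X * PowerSeries.X,
      PowerSeries.C 1 * PowerSeries.X]) : D.VanishesBelow m := by
  intro d hd
  have h1 := PowerSeries.X_pow_dvd_iff.mp h _ hd
  rw [coeff_subst_linear, MvPowerSeries.homogEval] at h1
  -- Setting the second variable to 1 loses nothing: the power of `T` records the total degree and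
  -- the power of x the first exponent.
  have h2 := congrArg (Polynomial.coeff · (d 0)) h1
  simp only [one_pow, mul_one, Polynomial.finsetSum_coeff, Polynomial.coeff_smul,
    Polynomial.coeff_X_pow, smul_eq_mul, mul_ite, mul_zero, Polynomial.coeff_zero] at h2
  rw [Finset.sum_ite_eq, if_pos (Finset.mem_range.mpr (by omega)), Nat.add_sub_cancel_left,
    expPair_surjective] at h2
  exact h2

end Curves

/-! ### Addition of curves and the defect of a series -/

namespace FormalGroup

open PowerSeries

variable {A B : Type*} [CommRing A] [CommRing B] [Algebra A B]

/-- The sum `F(u, v)` of two curves `u`, `v` with coefficients in an `A`-algebra. -/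
def curveAdd (F : FormalGroup A) (u v : B⟦X⟧) : B⟦X⟧ := F.toPowerSeries.subst ![u, v]

theorem curveAdd_def (F : FormalGroup A) (u v : B⟦X⟧) :
    F.curveAdd u v = F.toPowerSeries.subst ![u, v] := rfl

/-- The series `f(F(T₁, T₂)) - F(f(T₁), f(T₂))`. -/
def defect (F : FormalGroup A) (f : A⟦X⟧) : MvPowerSeries (Fin 2) A :=
  f.subst F.toPowerSeries - F.toPowerSeries.subst
    ![f.subst (MvPowerSeries.X 0 : MvPowerSeries (Fin 2) A),
      f.subst (MvPowerSeries.X 1 : MvPowerSeries (Fin 2) A)]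

theorem defect_subst (F : FormalGroup A) {f : A⟦X⟧} (hf : X ∣ f) {u v : B⟦X⟧} (hu : X ∣ u)
    (hv : X ∣ v) : (F.defect f).subst ![u, v] =
      f.subst (F.curveAdd u v) - F.curveAdd (f.subst u) (f.subst v) := by
  have huv := hasSubst_pair hu hv
  have h0 (i : Fin 2) : PowerSeries.HasSubst (MvPowerSeries.X i : MvPowerSeries (Fin 2) A) :=
    PowerSeries.HasSubst.of_constantCoeff_zero (by simp)
  have hf2 : MvPowerSeries.HasSubst
      ![f.subst (MvPowerSeries.X 0 : MvPowerSeries (Fin 2) A),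
        f.subst (MvPowerSeries.X 1 : MvPowerSeries (Fin 2) A)] :=
    MvPowerSeries.hasSubst_of_constantCoeff_zero fun s => by
      fin_cases s <;>
        exact PowerSeries.constantCoeff_subst_eq_zero (by simp) _ (X_dvd_iff.mp hf)
  rw [defect, MvPowerSeries.subst_sub huv, PowerSeries.subst,
    MvPowerSeries.subst_comp_subst_apply (Endo.hasSubst_law F).const huv,
    MvPowerSeries.subst_comp_subst_apply hf2 huv]
  refine congrArg₂ _ rfl ?_
  rw [curveAdd_def]
  congr 1
  funext s
  fin_cases s
  · simp [PowerSeries.subst, MvPowerSeries.subst_comp_subst_apply (h0 0).const huv,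
      MvPowerSeries.subst_X huv]
  · simp [PowerSeries.subst, MvPowerSeries.subst_comp_subst_apply (h0 1).const huv,
      MvPowerSeries.subst_X huv]

/-- Identifies the sum of curves with substitution into the base-changed law, so that the group
axioms apply to curves over any algebra. -/
theorem map_curveAdd (F : FormalGroup A) {u v : B⟦X⟧} (hu : X ∣ u) (hv : X ∣ v) :
    (F.map (algebraMap A B)).toPowerSeries.subst ![u, v] = F.curveAdd u v := by
  rw [curveAdd_def, map_toPowerSeries]
  ext k
  rw [coeff_subst_pair hu hv, coeff_subst_pair hu hv]
  refine finsum_congr fun d => ?_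
  rw [MvPowerSeries.coeff_map, algebraMap_smul]

theorem X_dvd_curveAdd (F : FormalGroup A) {u v : B⟦X⟧} (hu : X ∣ u) (hv : X ∣ v) :
    X ∣ F.curveAdd u v :=
  X_dvd_subst_pair hu hv F.zero_constantCoeff

theorem curveAdd_assoc (F : FormalGroup A) {u v w : B⟦X⟧} (hu : X ∣ u) (hv : X ∣ v)
    (hw : X ∣ w) : F.curveAdd (F.curveAdd u v) w = F.curveAdd u (F.curveAdd v w) := by
  rw [← map_curveAdd F (X_dvd_curveAdd F hu hv) hw, ← map_curveAdd F hu hv,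
    ← map_curveAdd F hu (X_dvd_curveAdd F hv hw), ← map_curveAdd F hv hw]
  exact (F.map (algebraMap A B)).assoc' (hasSubst_of_X_dvd hu) (hasSubst_of_X_dvd hv)
    (hasSubst_of_X_dvd hw)

theorem curveAdd_zero (F : FormalGroup A) {u : B⟦X⟧} (hu : X ∣ u) : F.curveAdd u 0 = u := by
  rw [← map_curveAdd F hu (dvd_zero X)]
  exact (F.map (algebraMap A B)).add_zero (hasSubst_of_X_dvd hu)

instance isComm_map (F : FormalGroup A) [F.IsComm] (φ : A →+* B) : (F.map φ).IsComm where
  comm := by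
    have h := congrArg (MvPowerSeries.map φ) (IsComm.comm (F := F))
    rw [MvPowerSeries.map_subst MvPowerSeries.HasSubst.X_X] at h
    rw [map_toPowerSeries]
    refine h.trans ?_
    congr 1
    funext s
    fin_cases s <;> simp

theorem curveAdd_comm (F : FormalGroup A) [F.IsComm] {u v : B⟦X⟧} (hu : X ∣ u) (hv : X ∣ v) :
    F.curveAdd u v = F.curveAdd v u := by
  rw [← map_curveAdd F hu hv, ← map_curveAdd F hv hu]
  exact (F.map (algebraMap A B)).comm' (hasSubst_of_X_dvd hu) (hasSubst_of_X_dvd hv)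

theorem vanishesBelow_sub_linear (F : FormalGroup A) :
    (F.toPowerSeries - MvPowerSeries.X 0 - MvPowerSeries.X 1).VanishesBelow 2 := by
  intro d hd
  have hcases : d = 0 ∨ d = Finsupp.single 0 1 ∨ d = Finsupp.single 1 1 := by
    have : (d 0 = 0 ∧ d 1 = 0) ∨ (d 0 = 1 ∧ d 1 = 0) ∨ (d 0 = 0 ∧ d 1 = 1) := by omega
    rcases this with h | h | h
    · left; ext s; fin_cases s <;> simp [h]
    · right; left; ext s; fin_cases s <;> simp [h]
    · right; right; ext s; fin_cases s <;> simp [h]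
  have h01 : (Finsupp.single (0 : Fin 2) 1 : Fin 2 →₀ ℕ) ≠ Finsupp.single 1 1 := fun h => by
    simpa using DFunLike.congr_fun h (0 : Fin 2)
  rcases hcases with rfl | rfl | rfl
  · simp [F.zero_constantCoeff]
  · simp [F.lin_coeff_X, MvPowerSeries.coeff_X, h01]
  · simp [F.lin_coeff_Y, MvPowerSeries.coeff_X, h01.symm]

theorem subst_sub_linear (F : FormalGroup A) {u v : B⟦X⟧} (hu : X ∣ u) (hv : X ∣ v) :
    (F.toPowerSeries - MvPowerSeries.X 0 - MvPowerSeries.X 1).subst ![u, v] =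
      F.curveAdd u v - u - v := by
  have huv := hasSubst_pair hu hv
  rw [MvPowerSeries.subst_sub huv, MvPowerSeries.subst_sub huv, MvPowerSeries.subst_X huv,
    MvPowerSeries.subst_X huv]
  rfl

theorem X_sq_dvd_curveAdd_sub (F : FormalGroup A) {u v : B⟦X⟧} (hu : X ∣ u) (hv : X ∣ v) :
    X ^ 2 ∣ F.curveAdd u v - (u + v) := by
  have := F.vanishesBelow_sub_linear.X_pow_dvd_subst (B := B) hu hv
  rwa [subst_sub_linear F hu hv, sub_sub] at this

/-- F(x,y) - x - y has order at least 2, so perturbations of order n simply add up to terms of order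
n + 1. -/
theorem X_pow_dvd_curveAdd_sub_sub (F : FormalGroup A) {n : ℕ} (hn : n ≠ 0) {u v u' v' : B⟦X⟧}
    (hu : X ∣ u) (hv : X ∣ v) (hu' : X ^ n ∣ u - u') (hv' : X ^ n ∣ v - v') :
    X ^ (n + 1) ∣ F.curveAdd u v - F.curveAdd u' v' - ((u - u') + (v - v')) := by
  obtain ⟨N, rfl⟩ := Nat.exists_eq_succ_of_ne_zero hn
  have hXu : X ∣ u' := (dvd_sub_right hu).mp ((dvd_pow_self X N.succ_ne_zero).trans hu')
  have hXv : X ∣ v' := (dvd_sub_right hv).mp ((dvd_pow_self X N.succ_ne_zero).trans hv')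
  have := F.vanishesBelow_sub_linear.X_pow_dvd_subst_sub (B := B) hu hv hu' hv'
  rw [subst_sub_linear F hu hv, subst_sub_linear F hXu hXv, add_comm] at this
  convert this using 1
  ring

theorem X_pow_dvd_curveAdd_sub (F : FormalGroup A) {n : ℕ} (hn : n ≠ 0) {u v u' v' : B⟦X⟧}
    (hu : X ∣ u) (hv : X ∣ v) (hu' : X ^ n ∣ u - u') (hv' : X ^ n ∣ v - v') :
    X ^ n ∣ F.curveAdd u v - F.curveAdd u' v' := by
  have h := (pow_dvd_pow X n.le_succ).trans (X_pow_dvd_curveAdd_sub_sub F hn hu hv hu' hv')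
  exact (dvd_sub_left (dvd_add hu' hv')).mp h

theorem subst_curveAdd (F : FormalGroup A) {u v : A⟦X⟧} (hu : X ∣ u) (hv : X ∣ v) {w : B⟦X⟧}
    (hw : X ∣ w) : (F.curveAdd u v).subst w = F.curveAdd (u.subst w) (v.subst w) := by
  rw [curveAdd_def, curveAdd_def, PowerSeries.subst,
    MvPowerSeries.subst_comp_subst_apply (hasSubst_pair hu hv) (hasSubst_of_X_dvd hw).const]
  congr 1
  funext s
  fin_cases s <;> rfl

theorem bracket_succ (F : FormalGroup A) (m : ℕ) :
    F.bracket (m + 1) = F.curveAdd (F.bracket m) X := rfl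

theorem X_dvd_bracket (F : FormalGroup A) (m : ℕ) : X ∣ F.bracket m := by
  induction m with
  | zero => exact dvd_zero X
  | succ m ih => exact X_dvd_curveAdd F ih dvd_rfl

theorem X_sq_dvd_bracket_sub (F : FormalGroup A) (m : ℕ) :
    X ^ 2 ∣ F.bracket m - C (m : A) * X := by
  induction m with
  | zero => simp [bracket]
  | succ m ih =>
    have := dvd_add (X_sq_dvd_curveAdd_sub F (X_dvd_bracket F m) (dvd_refl (X : A⟦X⟧))) ih
    rw [bracket_succ]
    convert this using 1
    push_cast
    rw [map_add, map_one]
    ring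

theorem bracket_map {R : Type*} [CommRing R] (F : FormalGroup A) (φ : A →+* R) (m : ℕ) :
    (F.map φ).bracket m = PowerSeries.map φ (F.bracket m) := by
  induction m with
  | zero => exact (map_zero _).symm
  | succ m ih =>
    rw [bracket_succ, bracket_succ, ih, curveAdd_def, curveAdd_def, map_toPowerSeries]
    refine Eq.trans ?_ (MvPowerSeries.map_subst (hasSubst_pair (X_dvd_bracket F m) dvd_rfl)
      F.toPowerSeries).symm
    congr 1
    funext s
    fin_cases s
    · rfl
    · exact (PowerSeries.map_X φ).symm

end FormalGroup

/-! ### The lowest part of the defect as a symmetric cocycle -/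

section

variable {A B : Type*} [CommRing A] [CommRing B] [Algebra A B]

open Polynomial in
-- Compares the coefficients of x^i y^j z^k, with z set to 1 and x, y the two polynomial variables.
-- As i, j, k are positive, the terms D(x,y) and D(y,z) contribute nothing.
theorem MvPowerSeries.coeff_homogEval_of_cocycle {D : MvPowerSeries (Fin 2) A} {n : ℕ}
    (h : ∀ x y z : A[X][X], D.homogEval n x y + D.homogEval n (x + y) z =
      D.homogEval n y z + D.homogEval n x (y + z)) {i j k : ℕ} (hi : 0 < i) (hj : 0 < j)
    (hk : 0 < k) (hijk : i + j + k = n) :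
    ((i + j).choose i : A) * coeff (expPair (i + j) (n - (i + j))) D =
      ((j + k).choose j : A) * coeff (expPair i (n - i)) D := by
  have h1 := congrArg (fun P => (P.coeff j).coeff i)
    (h (Polynomial.C Polynomial.X) Polynomial.X 1)
  simp only [homogEval, one_pow, mul_one, Polynomial.coeff_add, Polynomial.finsetSum_coeff,
    Polynomial.coeff_smul, ← Polynomial.C_pow, Polynomial.coeff_C_mul] at h1
  have e1 : ∀ l ∈ Finset.range (n + 1), coeff (expPair l (n - l)) D •
      ((Polynomial.X : A[X]) ^ l * (Polynomial.X ^ (n - l) : A[X][X]).coeff j).coeff i = 0 := by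
    intro l hl
    rw [Finset.mem_range] at hl
    rw [Polynomial.coeff_X_pow, mul_ite, mul_one, mul_zero]
    split_ifs with hjl
    · rw [Polynomial.coeff_X_pow, if_neg (by omega), smul_zero]
    · rw [Polynomial.coeff_zero, smul_zero]
  have e2 : ∀ l ∈ Finset.range (n + 1), l ≠ i + j → coeff (expPair l (n - l)) D •
      (((Polynomial.C Polynomial.X + Polynomial.X : A[X][X]) ^ l).coeff j).coeff i = 0 := by
    intro l _ hl
    rw [add_comm (Polynomial.C _), Polynomial.coeff_X_add_C_pow, ← Polynomial.C_eq_natCast,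
      Polynomial.coeff_mul_C, Polynomial.coeff_X_pow]
    rcases Nat.lt_or_ge l j with h | h
    · rw [Nat.choose_eq_zero_of_lt h, Nat.cast_zero, mul_zero, smul_zero]
    · rw [if_neg (by omega), zero_mul, smul_zero]
  have e3 : ∀ l ∈ Finset.range (n + 1), coeff (expPair l (n - l)) D •
      ((Polynomial.X ^ l : A[X][X]).coeff j).coeff i = 0 := by
    intro l _
    rw [Polynomial.coeff_X_pow]
    split_ifs
    · rw [Polynomial.coeff_one, if_neg (by omega), smul_zero]
    · rw [Polynomial.coeff_zero, smul_zero]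
  have e4 : ∀ l ∈ Finset.range (n + 1), l ≠ i → coeff (expPair l (n - l)) D •
      ((Polynomial.X : A[X]) ^ l * ((Polynomial.X + 1 : A[X][X]) ^ (n - l)).coeff j).coeff i
        = 0 := by
    intro l _ hl
    rw [Polynomial.coeff_X_add_one_pow, ← Polynomial.C_eq_natCast, Polynomial.coeff_mul_C,
      Polynomial.coeff_X_pow, if_neg (by omega), zero_mul, smul_zero]
  rw [Finset.sum_eq_zero e1, Finset.sum_eq_zero e3, zero_add, zero_add,
    Finset.sum_eq_single_of_mem (i + j) (Finset.mem_range.mpr (by omega)) e2,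
    Finset.sum_eq_single_of_mem i (Finset.mem_range.mpr (by omega)) e4,
    add_comm (Polynomial.C _), Polynomial.coeff_X_add_C_pow, Polynomial.coeff_X_add_one_pow,
    ← Polynomial.C_eq_natCast, ← Polynomial.C_eq_natCast,
    Polynomial.coeff_mul_C, Polynomial.coeff_mul_C,
    Polynomial.coeff_X_pow, Polynomial.coeff_X_pow, if_pos (by omega), if_pos rfl, one_mul,
    one_mul, show n - i = j + k by omega] at h1
  rw [show n - i = j + k by omega, mul_comm, mul_comm _ (coeff _ _),
    Nat.choose_symm_add (a := i) (b := j)]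
  exact h1

end

namespace FormalGroup

open PowerSeries

variable {A B : Type*} [CommRing A] [CommRing B] [Algebra A B]

theorem subst_curveAdd_eq (F : FormalGroup A) {f : A⟦X⟧} (hf : X ∣ f) {u v : B⟦X⟧} (hu : X ∣ u)
    (hv : X ∣ v) : f.subst (F.curveAdd u v) =
      F.curveAdd (f.subst u) (f.subst v) + (F.defect f).subst ![u, v] := by
  rw [defect_subst F hf hu hv, add_sub_cancel]

/-- Expand f at F(F(xT,yT),zT) = F(xT,F(yT,zT)) in both ways. Modulo T^(n+1) the defects add
linearly and F may be replaced by addition in their arguments; associativity of F cancels the rest.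
-/
theorem homogEval_defect_cocycle (F : FormalGroup A) {f : A⟦X⟧} (hf : X ∣ f) {n : ℕ} (hn : n ≠ 0)
    (hD : (F.defect f).VanishesBelow n) (x y z : B) :
    (F.defect f).homogEval n x y + (F.defect f).homogEval n (x + y) z =
      (F.defect f).homogEval n y z + (F.defect f).homogEval n x (y + z) := by
  have hX (x : B) : (X : B⟦X⟧) ∣ C x * X := dvd_mul_left X _
  have hfX (x : B) : (X : B⟦X⟧) ∣ f.subst (C x * X) := X_dvd_subst hf (hX x)
  have hdvd (x y : B) := hD.X_pow_dvd_subst (hX x) (hX y)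
  have hC (x y : B) : (C x * X + C y * X : B⟦X⟧) = C (x + y) * X := by rw [map_add, add_mul]
  have e1 : X ^ (n + 1) ∣ (F.defect f).subst ![F.curveAdd (C x * X) (C y * X), C z * X] -
      (F.defect f).subst ![C (x + y) * X, C z * X] :=
    hD.X_pow_dvd_subst_sub (X_dvd_curveAdd F (hX x) (hX y)) (hX z)
      (hC x y ▸ X_sq_dvd_curveAdd_sub F (hX x) (hX y)) (by simp)
  have e2 : X ^ (n + 1) ∣ (F.defect f).subst ![C x * X, F.curveAdd (C y * X) (C z * X)] -
      (F.defect f).subst ![C x * X, C (y + z) * X] :=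
    hD.X_pow_dvd_subst_sub (hX x) (X_dvd_curveAdd F (hX y) (hX z)) (by simp)
      (hC y z ▸ X_sq_dvd_curveAdd_sub F (hX y) (hX z))
  have e3 := X_pow_dvd_curveAdd_sub_sub F hn
    (X_dvd_subst hf (X_dvd_curveAdd F (hX x) (hX y))) (hfX z)
    (u' := F.curveAdd (f.subst (C x * X)) (f.subst (C y * X))) (v' := f.subst (C z * X))
    (by rw [subst_curveAdd_eq F hf (hX x) (hX y), add_sub_cancel_left]; exact hdvd x y) (by simp)
  have e4 := X_pow_dvd_curveAdd_sub_sub F hn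
    (hfX x) (X_dvd_subst hf (X_dvd_curveAdd F (hX y) (hX z)))
    (u' := f.subst (C x * X)) (v' := F.curveAdd (f.subst (C y * X)) (f.subst (C z * X))) (by simp)
    (by rw [subst_curveAdd_eq F hf (hX y) (hX z), add_sub_cancel_left]; exact hdvd y z)
  have h1 := subst_curveAdd_eq F hf (X_dvd_curveAdd F (hX x) (hX y)) (hX z)
  have h2 := subst_curveAdd_eq F hf (hX x) (X_dvd_curveAdd F (hX y) (hX z))
  rw [curveAdd_assoc F (hX x) (hX y) (hX z), h2] at h1
  rw [curveAdd_assoc F (hfX x) (hfX y) (hfX z), sub_self, _root_.add_zero,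
    subst_curveAdd_eq F hf (hX x) (hX y), add_sub_cancel_left] at e3
  rw [sub_self, _root_.zero_add, subst_curveAdd_eq F hf (hX y) (hX z), add_sub_cancel_left] at e4
  rw [subst_curveAdd_eq F hf (hX x) (hX y), subst_curveAdd_eq F hf (hX y) (hX z)] at h1
  have h3 : X ^ (n + 1) ∣ ((F.defect f).subst ![C x * X, C y * X] +
      (F.defect f).subst ![C (x + y) * X, C z * X]) -
      ((F.defect f).subst ![C y * X, C z * X] +
        (F.defect f).subst ![C x * X, C (y + z) * X] : B⟦X⟧) := by
    convert dvd_add (dvd_sub e4 e3) (dvd_sub e2 e1) using 1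
    linear_combination -h1
  have h4 := X_pow_dvd_iff.mp h3 n n.lt_succ_self
  rw [map_sub, map_add (coeff n), map_add (coeff n), coeff_subst_linear, coeff_subst_linear,
    coeff_subst_linear, coeff_subst_linear] at h4
  exact sub_eq_zero.mp h4

theorem homogEval_defect_comm (F : FormalGroup A) [F.IsComm] {f : A⟦X⟧} (hf : X ∣ f) (n : ℕ)
    (x y : B) : (F.defect f).homogEval n x y = (F.defect f).homogEval n y x := by
  have hX (x : B) : (X : B⟦X⟧) ∣ C x * X := dvd_mul_left X _
  rw [← coeff_subst_linear, ← coeff_subst_linear, defect_subst F hf (hX x) (hX y),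
    defect_subst F hf (hX y) (hX x), curveAdd_comm F (hX x) (hX y),
    curveAdd_comm F (X_dvd_subst hf (hX x)) (X_dvd_subst hf (hX y))]

theorem homogEval_defect_zero (F : FormalGroup A) {f : A⟦X⟧} (hf : X ∣ f) (n : ℕ)
    (x : B) : (F.defect f).homogEval n x 0 = 0 := by
  have hX (x : B) : (X : B⟦X⟧) ∣ C x * X := dvd_mul_left X _
  have h0 : (f.subst (0 : B⟦X⟧) : B⟦X⟧) = 0 :=
    PowerSeries.subst_zero_of_constantCoeff_zero (X_dvd_iff.mp hf)
  rw [← coeff_subst_linear, defect_subst F hf (hX x) (hX 0), map_zero, zero_mul, h0,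
    curveAdd_zero F (hX x), curveAdd_zero F (X_dvd_subst hf (hX x)), sub_self, map_zero]

open Polynomial in
theorem coeff_defect_symm (F : FormalGroup A) [F.IsComm] {f : A⟦X⟧} (hf : PowerSeries.X ∣ f)
    {n i : ℕ} (hi : i ≤ n) : MvPowerSeries.coeff (expPair (n - i) (n - (n - i))) (F.defect f) =
      MvPowerSeries.coeff (expPair i (n - i)) (F.defect f) := by
  have h := congrArg (fun P => Polynomial.coeff P i)
    (homogEval_defect_comm F hf n (1 : A[X]) (Polynomial.X : A[X]))
  simp only [MvPowerSeries.homogEval, one_pow, mul_one, one_mul, Polynomial.finsetSum_coeff,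
    Polynomial.coeff_smul, Polynomial.coeff_X_pow, smul_eq_mul, mul_ite, mul_zero] at h
  rw [Finset.sum_ite_eq, if_pos (Finset.mem_range.mpr (by omega)),
    Finset.sum_eq_single_of_mem (n - i) (Finset.mem_range.mpr (by omega)) (by
      intro l hl hne
      rw [Finset.mem_range] at hl
      exact if_neg (by omega)), if_pos (by omega)] at h
  exact h

theorem coeff_defect_right (F : FormalGroup A) {f : A⟦X⟧} (hf : X ∣ f) (n : ℕ) :
    MvPowerSeries.coeff (expPair n (n - n)) (F.defect f) = 0 := by
  have h := homogEval_defect_zero F hf n (1 : A)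
  rw [MvPowerSeries.homogEval, Finset.sum_eq_single_of_mem n (Finset.mem_range.mpr (by omega)) (by
    intro l hl hne
    rw [Finset.mem_range] at hl
    rw [zero_pow (by omega), mul_zero, smul_zero])] at h
  simpa using h

/-- Each step from [m] to [m+1] adds the defect at ([m](T), T). Since [m](T) ≡ mT modulo T², its
leading term is the value of the lowest part at (m, 1). -/
theorem X_pow_dvd_subst_bracket_sub (F : FormalGroup A) {f : A⟦X⟧} (hf : X ∣ f) {n : ℕ}
    (hn : n ≠ 0) (hD : (F.defect f).VanishesBelow n) (m : ℕ) :
    X ^ (n + 1) ∣ f.subst (F.bracket m) - (F.bracket m).subst f -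
      C (∑ r ∈ Finset.range m, (F.defect f).homogEval n (r : A) 1) * X ^ n := by
  induction m with
  | zero =>
    simp [bracket, PowerSeries.subst_zero_of_constantCoeff_zero (X_dvd_iff.mp hf),
      ← coe_substAlgHom (hasSubst_of_X_dvd hf)]
  | succ m ih =>
    have hb := X_dvd_bracket F m
    have hX : (X : A⟦X⟧) ∣ C (1 : A) * X := dvd_mul_left X _
    have e1 : X ^ (n + 1) ∣ (F.defect f).subst ![F.bracket m, X] -
        C ((F.defect f).homogEval n (m : A) 1) * X ^ n := by
      have h1 := hD.X_pow_dvd_subst_sub (N := 1) hb dvd_rfl (X_sq_dvd_bracket_sub F m)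
        (v' := C 1 * X) (by simp)
      have h2 : X ^ (n + 1) ∣ ((F.defect f).subst ![C (m : A) * X, C 1 * X] : A⟦X⟧) -
          C ((F.defect f).homogEval n (m : A) 1) * X ^ n := by
        refine X_pow_dvd_iff.mpr fun k hk => ?_
        rw [map_sub, coeff_C_mul, coeff_X_pow]
        split_ifs with h
        · rw [h, coeff_subst_linear, mul_one, sub_self]
        · rw [X_pow_dvd_iff.mp (hD.X_pow_dvd_subst (dvd_mul_left X _) hX) k (by omega)]
          simp
      simpa using dvd_add h1 h2
    have e2 : X ^ n ∣ f.subst (F.bracket m) - (F.bracket m).subst f := by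
      have := dvd_add ((pow_dvd_pow X n.le_succ).trans ih)
        (dvd_mul_left (X ^ n) (C (∑ r ∈ Finset.range m, (F.defect f).homogEval n (r : A) 1)))
      simpa using this
    have e3 := X_pow_dvd_curveAdd_sub_sub F hn (X_dvd_subst hf hb) hf e2
      (v' := f) (by simp)
    rw [bracket_succ, subst_curveAdd_eq F hf hb dvd_rfl, subst_curveAdd F hb dvd_rfl hf,
      PowerSeries.X_subst, PowerSeries.subst_X (hasSubst_of_X_dvd hf), Finset.sum_range_succ,
      map_add]
    convert dvd_add (dvd_add e1 e3) ih using 1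
    ring

theorem X_pow_dvd_subst_sub_subst {f g : A⟦X⟧} {m : ℕ} (hfg : X ^ m ∣ f - g) {w : B⟦X⟧}
    (hw : X ∣ w) : X ^ m ∣ f.subst w - g.subst w := by
  obtain ⟨r, hr⟩ := hfg
  have hs := hasSubst_of_X_dvd hw
  rw [← PowerSeries.subst_sub hs, hr, PowerSeries.subst_mul hs, PowerSeries.subst_pow hs,
    PowerSeries.subst_X hs]
  exact (pow_dvd_pow_of_dvd hw m).trans (dvd_mul_right _ _)

theorem X_pow_dvd_defect_subst_sub (F : FormalGroup A) {f g : A⟦X⟧} {m : ℕ} (hm : m ≠ 0)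
    (hf : X ∣ f) (hfg : X ^ m ∣ f - g) {u v : B⟦X⟧} (hu : X ∣ u) (hv : X ∣ v) :
    X ^ m ∣ (F.defect f).subst ![u, v] - (F.defect g).subst ![u, v] := by
  have hg : X ∣ g := (dvd_sub_right hf).mp ((dvd_pow_self X hm).trans hfg)
  rw [defect_subst F hf hu hv, defect_subst F hg hu hv, sub_sub_sub_comm]
  exact dvd_sub (X_pow_dvd_subst_sub_subst hfg (X_dvd_curveAdd F hu hv))
    (X_pow_dvd_curveAdd_sub F hm (X_dvd_subst hf hu) (X_dvd_subst hf hv)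
      (X_pow_dvd_subst_sub_subst hfg hu) (X_pow_dvd_subst_sub_subst hfg hv))

theorem defect_vanishesBelow_congr (F : FormalGroup A) {f g : A⟦X⟧} {m : ℕ} (hm : m ≠ 0)
    (hf : X ∣ f) (hfg : X ^ m ∣ f - g) (hD : (F.defect f).VanishesBelow m) :
    (F.defect g).VanishesBelow m := by
  refine MvPowerSeries.vanishesBelow_of_curve ?_
  have hX (x : Polynomial A) : X ∣ C x * X := dvd_mul_left X _
  exact (dvd_sub_right (hD.X_pow_dvd_subst (hX _) (hX _))).mp
    (X_pow_dvd_defect_subst_sub F hm hf hfg (hX _) (hX _))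

/-- Adding cT^n changes the degree n part of the defect by a coboundary, because all interaction
with the nonlinear terms of F has order above n. -/
theorem X_pow_dvd_defect_add_monomial (F : FormalGroup A) {f : A⟦X⟧} {n : ℕ} (hn : n ≠ 0)
    (hf : X ∣ f) (c : A) (x y : B) :
    X ^ (n + 1) ∣ (F.defect (f + C c * X ^ n)).subst ![C x * X, C y * X] -
      ((F.defect f).subst ![C x * X, C y * X] +
        C (c • ((x + y) ^ n - x ^ n - y ^ n)) * X ^ n : B⟦X⟧) := by
  have hX (x : B) : (X : B⟦X⟧) ∣ C x * X := dvd_mul_left X _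
  have hg : X ∣ f + C c * X ^ n := dvd_add hf ((dvd_pow_self X hn).mul_left _)
  have key {w : B⟦X⟧} (hw : X ∣ w) : ((f + C c * X ^ n).subst w : B⟦X⟧) =
      f.subst w + C (algebraMap A B c) * w ^ n := by
    have hs := hasSubst_of_X_dvd hw
    rw [PowerSeries.subst_add hs, PowerSeries.subst_mul hs, PowerSeries.subst_pow hs,
      PowerSeries.subst_X hs, ← smul_eq_C_mul, ← mul_one (C c), ← smul_eq_C_mul,
      PowerSeries.subst_smul hs, ← coe_substAlgHom hs, map_one, smul_mul_assoc, one_mul,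
      algebraMap_smul]
  have e1 : X ^ (n + 1) ∣ F.curveAdd (C x * X) (C y * X) ^ n - (C (x + y) * X) ^ n := by
    have := X_pow_dvd_mul_pow_sub (m := n) (i := n) (j := 0) (N := 1) (le_refl n)
      (X_dvd_curveAdd F (hX x) (hX y)) (hX x) (u' := C (x + y) * X) (v' := C x * X)
      (by rw [map_add, add_mul]; exact X_sq_dvd_curveAdd_sub F (hX x) (hX y)) (by simp)
    simpa using this
  have e2 := X_pow_dvd_curveAdd_sub_sub F hn (X_dvd_subst hg (hX x)) (X_dvd_subst hg (hX y))
    (u' := f.subst (C x * X)) (v' := f.subst (C y * X))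
    (by rw [key (hX x), add_sub_cancel_left, mul_pow]
        exact ((dvd_mul_left _ _).mul_left _))
    (by rw [key (hX y), add_sub_cancel_left, mul_pow]
        exact ((dvd_mul_left _ _).mul_left _))
  rw [defect_subst F hg (hX x) (hX y), defect_subst F hf (hX x) (hX y),
    key (X_dvd_curveAdd F (hX x) (hX y))]
  convert dvd_sub (e1.mul_left (C (algebraMap A B c))) e2 using 1
  rw [key (hX x), key (hX y), Algebra.smul_def]
  simp only [map_mul, map_sub, map_pow, mul_pow, map_add]
  ring

end FormalGroup

/-! ### Frobenius and the coefficients of a power series -/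

section Frobenius

open PowerSeries

variable {A : Type*} [CommRing A] {p : ℕ} [Fact p.Prime]

theorem PowerSeries.coeff_pow_prime_pow (hA : (p : A) = 0) (h : ℕ) (f : A⟦X⟧) (n : ℕ) :
    coeff n (f ^ p ^ h) = if p ^ h ∣ n then coeff (n / p ^ h) f ^ p ^ h else 0 := by
  have hp : p.Prime := Fact.out
  rcases subsingleton_or_nontrivial A with hs | hs
  · exact Subsingleton.elim _ _
  have : CharP A p := by
    obtain ⟨r, hr⟩ := CharP.exists A
    rcases (Nat.dvd_prime hp).mp ((CharP.cast_eq_zero_iff A r p).mp hA) with h1 | h1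
    · subst h1
      exact absurd rfl (CharP.char_ne_one A 1)
    · exact h1 ▸ hr
  have : ExpChar A p := ExpChar.prime hp
  have key : f ^ p ^ h = PowerSeries.map (iterateFrobenius A p h)
      (f.expand (p ^ h) (pow_ne_zero h hp.ne_zero)) :=
    (MvPowerSeries.map_iterateFrobenius_expand p hp.ne_zero f h).symm
  rw [key, coeff_map, coeff_expand]
  split_ifs
  · exact iterateFrobenius_def ..
  · exact map_zero _

/-- This is the bridge between commuting with T^(p^h) and coefficients fixed by Frobenius. One
direction bounds the coefficients of endomorphisms, the other kills the obstruction to constructing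
them. -/
theorem PowerSeries.pow_prime_pow_eq_subst_iff (hA : (p : A) = 0) (h : ℕ) (f : A⟦X⟧) :
    f ^ p ^ h = f.subst (X ^ p ^ h : A⟦X⟧) ↔ ∀ k, coeff k f ^ p ^ h = coeff k f := by
  have hp : p ^ h ≠ 0 := pow_ne_zero h (Fact.out : p.Prime).ne_zero
  constructor
  · intro H k
    have := congrArg (coeff (p ^ h * k)) H
    rwa [coeff_pow_prime_pow hA, coeff_subst_X_pow hp, if_pos (dvd_mul_right _ _),
      if_pos (dvd_mul_right _ _), Nat.mul_div_cancel_left _ (Nat.pos_of_ne_zero hp)] at this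
  · intro H
    ext n
    rw [coeff_pow_prime_pow hA, coeff_subst_X_pow hp, H]
    rfl

end Frobenius

/-! ### Constraints on endomorphisms and their construction -/

namespace FormalGroup

open PowerSeries

variable {A B : Type*} [CommRing A] [CommRing B] [Algebra A B] {p h : ℕ} [Fact p.Prime]

open Polynomial in
theorem defect_eq_zero_of_curve (F : FormalGroup A) {f : A⟦X⟧} (hf : PowerSeries.X ∣ f)
    (H : ∀ u v : A[X]⟦X⟧, PowerSeries.X ∣ u → PowerSeries.X ∣ v →
      f.subst (F.curveAdd u v) = F.curveAdd (f.subst u) (f.subst v)) : F.defect f = 0 := by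
  ext d
  refine MvPowerSeries.vanishesBelow_of_curve (m := d 0 + d 1 + 1) ?_ d (by omega)
  rw [defect_subst F hf (dvd_mul_left _ _) (dvd_mul_left _ _),
    H _ _ (dvd_mul_left _ _) (dvd_mul_left _ _), sub_self]
  exact dvd_zero _

theorem defect_X (F : FormalGroup A) : F.defect X = 0 :=
  sub_eq_zero.mpr (1 : F.Endo).map_law

theorem defect_zero (F : FormalGroup A) : F.defect 0 = 0 := by
  refine defect_eq_zero_of_curve F (dvd_zero X) fun u v hu hv => ?_
  have h0 {w : (Polynomial A)⟦X⟧} (hw : X ∣ w) : ((0 : A⟦X⟧).subst w : (Polynomial A)⟦X⟧) = 0 := by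
    rw [← coe_substAlgHom (hasSubst_of_X_dvd hw), map_zero]
  rw [h0 hu, h0 hv, h0 (X_dvd_curveAdd F hu hv), curveAdd_zero F (dvd_zero X)]

/-- The endomorphism given by a series with vanishing defect. -/
def Endo.ofDefect {F : FormalGroup A} (f : A⟦X⟧) (hf : X ∣ f) (hD : F.defect f = 0) : F.Endo where
  toSeries := f
  constantCoeff_eq := X_dvd_iff.mp hf
  map_law := sub_eq_zero.mp hD

theorem Endo.X_dvd {F : FormalGroup A} (f : F.Endo) : X ∣ f.toSeries :=
  X_dvd_iff.mpr f.constantCoeff_eq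

theorem Endo.defect_eq_zero {F : FormalGroup A} (f : F.Endo) : F.defect f.toSeries = 0 :=
  sub_eq_zero.mpr f.map_law

theorem Endo.subst_curveAdd_eq {F : FormalGroup A} (f : F.Endo) {u v : B⟦X⟧} (hu : X ∣ u)
    (hv : X ∣ v) : f.toSeries.subst (F.curveAdd u v) =
      F.curveAdd (f.toSeries.subst u) (f.toSeries.subst v) := by
  rw [FormalGroup.subst_curveAdd_eq F f.X_dvd hu hv, f.defect_eq_zero,
    zero_subst_pair hu hv, _root_.add_zero]

theorem Endo.subst_bracket {F : FormalGroup A} (f : F.Endo) (m : ℕ) :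
    f.toSeries.subst (F.bracket m) = (F.bracket m).subst f.toSeries := by
  induction m with
  | zero =>
    simp [bracket, PowerSeries.subst_zero_of_constantCoeff_zero f.constantCoeff_eq,
      ← coe_substAlgHom f.hasSubst]
  | succ m ih =>
    rw [bracket_succ, f.subst_curveAdd_eq (X_dvd_bracket F m) dvd_rfl,
      subst_curveAdd F (X_dvd_bracket F m) dvd_rfl f.X_dvd, ih, PowerSeries.X_subst,
      PowerSeries.subst_X f.hasSubst]

theorem Endo.coeff_pow_eq {F : FormalGroup A} (hA : (p : A) = 0)
    (hF : F.bracket p = X ^ p ^ h) (f : F.Endo) (k : ℕ) :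
    coeff k f.toSeries ^ p ^ h = coeff k f.toSeries := by
  refine (pow_prime_pow_eq_subst_iff hA h _).mp ?_ k
  rw [← hF, f.subst_bracket, hF, PowerSeries.subst_pow f.hasSubst, PowerSeries.subst_X f.hasSubst]

/-- The compositional inverse exists as a series; it respects F because f does and may be cancelled
on curves. -/
theorem Endo.isUnit_of_isUnit_coeff_one {F : FormalGroup A} (f : F.Endo)
    (hu : IsUnit (coeff 1 f.toSeries)) : IsUnit f := by
  have hc := f.constantCoeff_eq
  set g := f.toSeries.substInvOfIsUnit hu with hg
  have hg0 : constantCoeff g = 0 := constantCoeff_substInvOfIsUnit _ _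
  have hgX : X ∣ g := X_dvd_iff.mpr hg0
  have hgf : g.subst f.toSeries = X := subst_substInvOfIsUnit_left _ hc hu
  have hfg : f.toSeries.subst g = X := subst_substInvOfIsUnit_right _ hc hu
  have hD : F.defect g = 0 := by
    refine defect_eq_zero_of_curve F hgX fun u v hu hv => ?_
    have e {w : (Polynomial A)⟦X⟧} (hw : X ∣ w) : f.toSeries.subst (g.subst w) = w := by
      rw [← PowerSeries.subst_comp_subst_apply (hasSubst_of_X_dvd hgX) (hasSubst_of_X_dvd hw), hfg,
        PowerSeries.subst_X (hasSubst_of_X_dvd hw)]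
    have e' {w : (Polynomial A)⟦X⟧} (hw : X ∣ w) : g.subst (f.toSeries.subst w) = w := by
      rw [← PowerSeries.subst_comp_subst_apply f.hasSubst (hasSubst_of_X_dvd hw), hgf,
        PowerSeries.subst_X (hasSubst_of_X_dvd hw)]
    have hgu := X_dvd_subst hgX hu
    have hgv := X_dvd_subst hgX hv
    conv_lhs => rw [← e hu, ← e hv, ← f.subst_curveAdd_eq hgu hgv, e' (X_dvd_curveAdd F hgu hgv)]
  exact ⟨⟨f, Endo.ofDefect g hgX hD, Endo.ext hfg, Endo.ext hgf⟩, rfl⟩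

open Polynomial in
-- The inductive step of the construction: the lowest part of the defect is a coboundary, which a
-- single monomial removes.
theorem exists_defect_vanishesBelow_succ (F : FormalGroup A) [F.IsComm] (hA : (p : A) = 0)
    (hfix : ∀ a : A, a ^ p ^ h = a) (hF : F.bracket p = PowerSeries.X ^ p ^ h) {f : A⟦X⟧}
    (hf : PowerSeries.X ∣ f) {n : ℕ} (hn : n ≠ 0) (hD : (F.defect f).VanishesBelow n) :
    ∃ c : A, (F.defect (f + PowerSeries.C c * PowerSeries.X ^ n)).VanishesBelow (n + 1) := by
  set γ : ℕ → A := fun i => MvPowerSeries.coeff (expPair i (n - i)) (F.defect f) with hγ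
  have hsymm (i : ℕ) (hi : i ≤ n) : γ (n - i) = γ i := coeff_defect_symm F hf hi
  have hγn : γ n = 0 := coeff_defect_right F hf n
  have hγ0 : γ 0 = 0 := by rw [← hγn, ← hsymm n le_rfl, Nat.sub_self]
  have hsum : ∑ m ∈ Finset.range p, ∑ i ∈ Finset.Ioo 0 n, γ i * (m : A) ^ i = 0 := by
    -- All coefficients are fixed by Frobenius, so f commutes with [p](T) = T^(p^h) exactly and the
    -- obstruction sum must vanish.
    have h1 := X_pow_dvd_subst_bracket_sub F hf hn hD p
    rw [hF, PowerSeries.subst_pow (hasSubst_of_X_dvd hf),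
      PowerSeries.subst_X (hasSubst_of_X_dvd hf),
      (pow_prime_pow_eq_subst_iff hA h f).mpr fun k => hfix _, sub_self, zero_sub, dvd_neg] at h1
    have h2 := PowerSeries.X_pow_dvd_iff.mp h1 n n.lt_succ_self
    rw [PowerSeries.coeff_C_mul, PowerSeries.coeff_X_pow_self, mul_one] at h2
    rw [← h2]
    refine Finset.sum_congr rfl fun m _ => ?_
    rw [MvPowerSeries.homogEval]
    refine (Finset.sum_subset (fun i hi => ?_) fun i hi hi' => ?_).trans
      (Finset.sum_congr rfl fun i _ => by rw [one_pow, mul_one, smul_eq_mul])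
    · rw [Finset.mem_Ioo] at hi
      exact Finset.mem_range.mpr (by omega)
    · rw [Finset.mem_range] at hi
      rw [Finset.mem_Ioo] at hi'
      obtain rfl | rfl : i = 0 ∨ i = n := by omega
      · rw [hγ0, zero_mul]
      · rw [hγn, zero_mul]
  obtain ⟨c, hc⟩ := exists_eq_mul_choose_of_symmetric_cocycle hA n γ
    (fun i _ hi => hsymm i hi.le)
    (fun i j k hi hj hk hijk => MvPowerSeries.coeff_homogEval_of_cocycle
      (homogEval_defect_cocycle F hf hn hD) hi hj hk hijk) hsum
  -- The sign makes the coboundary of the added monomial cancel the degree n part of the defect.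
  refine ⟨-c, MvPowerSeries.vanishesBelow_of_curve ?_⟩
  have h1 := X_pow_dvd_defect_add_monomial F hn hf (-c) (Polynomial.X : A[X]) (1 : A[X])
  refine (dvd_sub_left ?_).mp h1
  refine PowerSeries.X_pow_dvd_iff.mpr fun k hk => ?_
  rw [map_add, PowerSeries.coeff_C_mul, PowerSeries.coeff_X_pow]
  split_ifs with hkn
  · subst hkn
    rw [coeff_subst_linear, mul_one]
    ext l
    simp only [MvPowerSeries.homogEval, one_pow, mul_one, Polynomial.coeff_add,
      Polynomial.finsetSum_coeff, Polynomial.coeff_smul, Polynomial.coeff_sub,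
      Polynomial.coeff_X_pow, Polynomial.coeff_X_add_one_pow, Polynomial.coeff_one,
      smul_eq_mul, mul_ite, mul_zero, Polynomial.coeff_zero]
    rw [Finset.sum_ite_eq]
    rcases Nat.eq_zero_or_pos l with rfl | hl0
    · rw [if_pos (Finset.mem_range.mpr (by omega)), if_neg (Ne.symm hn), if_pos rfl,
        Nat.choose_zero_right]
      change γ 0 + _ = 0
      rw [hγ0]
      simp
    rcases Nat.lt_trichotomy l k with hl | rfl | hl
    · rw [if_pos (Finset.mem_range.mpr (by omega)), if_neg hl.ne, if_neg hl0.ne']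
      change γ l + _ = 0
      rw [hc l hl0 hl]
      ring
    · rw [if_pos (Finset.mem_range.mpr (by omega)), if_pos rfl, if_neg hl0.ne', Nat.choose_self]
      change γ l + _ = 0
      rw [hγn]
      simp
    · rw [if_neg (by simp; omega), if_neg hl.ne', if_neg hl0.ne', Nat.choose_eq_zero_of_lt hl]
      simp
  · rw [PowerSeries.X_pow_dvd_iff.mp (hD.X_pow_dvd_subst (dvd_mul_left _ _) (dvd_mul_left _ _)) k
      (by omega)]
    simp

/-- Successive corrections have degrees n, n + 1, …, so they converge in the `X`-adic topology, and
the defect of the limit vanishes to every order. -/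
theorem exists_endo_of_vanishesBelow (F : FormalGroup A) [F.IsComm] (hA : (p : A) = 0)
    (hfix : ∀ a : A, a ^ p ^ h = a) (hF : F.bracket p = X ^ p ^ h) {f₀ : A⟦X⟧}
    (hf₀ : X ∣ f₀) {n : ℕ} (hn : n ≠ 0) (hD : (F.defect f₀).VanishesBelow n) :
    ∃ f : F.Endo, X ^ n ∣ f.toSeries - f₀ := by
  have step (k : ℕ) (f : A⟦X⟧) : ∃ g : A⟦X⟧, X ∣ f ∧ (F.defect f).VanishesBelow (n + k) →
      X ^ (n + k) ∣ g - f ∧ X ∣ g ∧ (F.defect g).VanishesBelow (n + (k + 1)) := by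
    by_cases hfk : X ∣ f ∧ (F.defect f).VanishesBelow (n + k)
    · obtain ⟨c, hc⟩ := exists_defect_vanishesBelow_succ F hA hfix hF hfk.1
        (n := n + k) (by omega) hfk.2
      refine ⟨_, fun _ => ⟨?_, ?_, hc⟩⟩
      · rw [add_sub_cancel_left]
        exact dvd_mul_left _ _
      · exact dvd_add hfk.1 ((dvd_pow_self X (by omega)).mul_left _)
    -- A default value that makes the step a total function; the sequence `s` never reaches it.
    · exact ⟨0, fun h => absurd h hfk⟩
  choose g hg using step
  let s : ℕ → A⟦X⟧ := fun k => Nat.rec f₀ (fun k f => g k f) k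
  have hs (k : ℕ) : X ∣ s k ∧ (F.defect (s k)).VanishesBelow (n + k) := by
    induction k with
    | zero => exact ⟨hf₀, hD⟩
    | succ k ih => exact (hg k (s k) ih).2
  have hdiff (k k' : ℕ) (hk : k ≤ k') : X ^ (n + k) ∣ s k' - s k := by
    induction k', hk using Nat.le_induction with
    | base => simp
    | succ m hm ih =>
      have h1 := (pow_dvd_pow X (by omega : n + k ≤ n + m)).trans (hg m (s m) (hs m)).1
      have h2 := dvd_add h1 ih
      rwa [sub_add_sub_cancel] at h2
  -- The coefficient of T^k is stable from stage k + 1 on, so the diagonal choice is the limit.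
  let f : A⟦X⟧ := PowerSeries.mk fun k => coeff k (s (k + 1))
  have hfs (k : ℕ) : X ^ (n + k) ∣ f - s k := by
    refine X_pow_dvd_iff.mpr fun j hj => ?_
    rw [map_sub, coeff_mk]
    rcases le_total (j + 1) k with h1 | h1
    · rw [← neg_sub, ← map_sub, X_pow_dvd_iff.mp (hdiff _ _ h1) j (by omega), neg_zero]
    · rw [← map_sub, X_pow_dvd_iff.mp (hdiff _ _ h1) j hj]
  have hfX : X ∣ f := (dvd_sub_left hf₀).mp ((dvd_pow_self X hn).trans (hfs 0))
  have hDf : F.defect f = 0 := by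
    ext d
    refine defect_vanishesBelow_congr F (m := n + (d 0 + d 1 + 1)) (by omega) (hs _).1 ?_ (hs _).2
      d (by omega)
    rw [← neg_sub, dvd_neg]
    exact hfs _
  exact ⟨Endo.ofDefect f hfX hDf, hfs 0⟩

theorem exists_endo_coeff_one_eq (F : FormalGroup A) [F.IsComm] (hA : (p : A) = 0)
    (hfix : ∀ a : A, a ^ p ^ h = a) (hF : F.bracket p = X ^ p ^ h) (a : A) :
    ∃ f : F.Endo, coeff 1 f.toSeries = a := by
  have hX : (X : A⟦X⟧) ∣ 0 + C a * X ^ 1 := by simp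
  have hD : (F.defect (0 + C a * X ^ 1)).VanishesBelow 2 := by
    refine MvPowerSeries.vanishesBelow_of_curve ?_
    have h1 := X_pow_dvd_defect_add_monomial F one_ne_zero (dvd_zero X) a
      (Polynomial.X : Polynomial A) (1 : Polynomial A)
    rw [defect_zero F, zero_subst_pair (dvd_mul_left X _) (dvd_mul_left X _)] at h1
    simpa using h1
  obtain ⟨f, hf⟩ := exists_endo_of_vanishesBelow F hA hfix hF hX two_ne_zero hD
  refine ⟨f, ?_⟩
  have := X_pow_dvd_iff.mp hf 1 one_lt_two
  rw [map_sub, sub_eq_zero] at this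
  rw [this]
  simp

/-- The monomial T^(p^j) is additive in characteristic p, so adding aT^(p^j) to the identity creates
no defect in degrees up to p^j. -/
theorem exists_endo_eq_X_add (F : FormalGroup A) [F.IsComm] (hA : (p : A) = 0)
    (hfix : ∀ a : A, a ^ p ^ h = a) (hF : F.bracket p = X ^ p ^ h) (a : A) (j : ℕ) :
    ∃ f : F.Endo, X ^ (p ^ j + 1) ∣ f.toSeries - (X + C a * X ^ p ^ j) := by
  have hp : p ^ j ≠ 0 := pow_ne_zero j (Fact.out : p.Prime).ne_zero
  refine exists_endo_of_vanishesBelow F hA hfix hF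
    (dvd_add dvd_rfl ((dvd_pow_self X hp).mul_left _)) (by omega) ?_
  refine MvPowerSeries.vanishesBelow_of_curve ?_
  have h1 := X_pow_dvd_defect_add_monomial F hp (dvd_refl X) a
    (Polynomial.X : Polynomial A) (1 : Polynomial A)
  have h2 := add_pow_prime_pow_eq (Fact.out : p.Prime) (Polynomial.X : Polynomial A) 1 j
  rw [show (p : Polynomial A) = 0 by rw [← Polynomial.C_eq_natCast, hA, map_zero], zero_mul,
    zero_mul, zero_mul, _root_.add_zero] at h2
  rw [defect_X F, zero_subst_pair (dvd_mul_left X _) (dvd_mul_left X _), h2] at h1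
  simpa using h1

/-- The first coefficient of an endomorphism congruent to `T` vanishes outside the degrees that are
powers of `p`. -/
theorem Endo.coeff_eq_zero_of_X_pow_dvd {F : FormalGroup A} (hA : (p : A) = 0) (f : F.Endo) {n : ℕ}
    (hn : n ≠ 0) (hf : X ^ n ∣ f.toSeries - X) (hnp : ∀ j, n ≠ p ^ j) :
    coeff n (f.toSeries - X) = 0 := by
  set a := coeff n (f.toSeries - X) with ha
  have h1 : X ^ (n + 1) ∣ f.toSeries - (X + C a * X ^ n) := by
    refine X_pow_dvd_iff.mpr fun k hk => ?_
    rw [← sub_sub, map_sub, coeff_C_mul, coeff_X_pow]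
    split_ifs with hkn
    · rw [hkn, mul_one, ha, sub_self]
    · rw [X_pow_dvd_iff.mp hf k (by omega), mul_zero, sub_zero]
  -- The truncation agrees with an endomorphism modulo T^(n+1), so its defect, whose degree n part
  -- is a((x+y)^n - x^n - y^n), vanishes through degree n.
  have h2 : (F.defect (X + C a * X ^ n)).VanishesBelow (n + 1) :=
    defect_vanishesBelow_congr F (by omega) f.X_dvd h1 fun d _ => by
      rw [f.defect_eq_zero, map_zero]
  have h3 := X_pow_dvd_defect_add_monomial F hn (dvd_refl X) a
    (Polynomial.X : Polynomial A) (1 : Polynomial A)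
  rw [defect_X F, zero_subst_pair (dvd_mul_left X _) (dvd_mul_left X _),
    _root_.zero_add,
    dvd_sub_right (h2.X_pow_dvd_subst (dvd_mul_left _ _) (dvd_mul_left _ _))] at h3
  have h4 := X_pow_dvd_iff.mp h3 n n.lt_succ_self
  rw [coeff_C_mul, coeff_X_pow_self, mul_one] at h4
  by_contra hne
  -- If p divided every intermediate binomial coefficient, n would be a power of p; one not
  -- divisible by p is a unit in `A` and forces a = 0.
  refine hnp _ (Choose.eq_pow_multiplicity_of_choose_modEq_zero_nat (p := p)
    (Nat.pos_of_ne_zero hn) fun l hl => ?_)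
  rw [Finset.mem_Icc] at hl
  by_contra hmod
  have hunit : IsUnit ((n.choose l : ℕ) : A) :=
    isUnit_natCast_of_not_dvd hA fun hd => hmod (Nat.modEq_zero_iff_dvd.mpr hd)
  have h5 := congrArg (fun P => Polynomial.coeff P l) h4
  simp only [one_pow, Polynomial.coeff_smul, Polynomial.coeff_sub, Polynomial.coeff_X_pow,
    Polynomial.coeff_X_add_one_pow, Polynomial.coeff_one, smul_eq_mul,
    Polynomial.coeff_zero] at h5
  rw [if_neg (by omega), if_neg (by omega), sub_zero, sub_zero] at h5
  exact hne (hunit.mul_left_eq_zero.mp h5)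

end FormalGroup

/-- The subring of the elements of `A` fixed by the `p^h`-th power map. -/
def frobFixedSubring (p h : ℕ) [Fact p.Prime] (A : Type*) [CommRing A] (hA : (p : A) = 0) :
    Subring A where
  __ := frobFixed p h A hA
  one_mem' := one_pow _
  mul_mem' := by
    intro a b ha hb
    exact (mul_pow a b _).trans (congrArg₂ (· * ·) ha hb)

/-! ### Leading coefficients on the filtration -/

namespace FormalGroup

open PowerSeries

section Coeff

variable {A : Type*} [CommRing A] {F : FormalGroup A}

theorem Endo.coeff_one_mul (f g : F.Endo) :
    coeff 1 (f * g).toSeries = coeff 1 f.toSeries * coeff 1 g.toSeries := by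
  have h : X ^ 2 ∣ f.toSeries - C (coeff 1 f.toSeries) * X := by
    refine X_pow_dvd_iff.mpr fun k hk => ?_
    rw [map_sub, coeff_C_mul, coeff_X]
    split_ifs with h1
    · rw [h1, mul_one, sub_self]
    · obtain rfl : k = 0 := by omega
      simp [f.constantCoeff_eq]
  have h1 := X_pow_dvd_iff.mp (X_pow_dvd_subst_sub_subst h g.X_dvd) 1 one_lt_two
  rw [← smul_eq_C_mul, PowerSeries.subst_smul g.hasSubst, PowerSeries.subst_X g.hasSubst, map_sub,
    sub_eq_zero] at h1
  exact h1

theorem mem_autFil_iff_X_pow_dvd {i : ℕ} {f : F.Auto} :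
    f ∈ F.autFil i ↔ X ^ (i + 1) ∣ f.val.toSeries - X := by
  rw [mem_autFil, X_pow_dvd_iff]
  refine forall_congr' fun k => ?_
  rw [map_sub, sub_eq_zero, Nat.lt_succ_iff]

/-- With f = T + T^(i+1) r, the composite is g + g^(i+1) r(g). For i ≠ 0 the series g starts with T
exactly, so g^(i+1) r(g) contributes r(0) in degree i + 1. -/
theorem coeff_mul_of_mem_autFil {i : ℕ} (hi : i ≠ 0) {f g : F.Auto} (hf : f ∈ F.autFil i)
    (hg : g ∈ F.autFil i) : coeff (i + 1) (f * g).val.toSeries =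
      coeff (i + 1) f.val.toSeries + coeff (i + 1) g.val.toSeries := by
  rw [mem_autFil_iff_X_pow_dvd] at hf hg
  obtain ⟨r, hr⟩ := hf
  obtain ⟨s, hs⟩ := hg
  have hsub := g.val.hasSubst
  have h1 : f.val.toSeries.subst g.val.toSeries =
      g.val.toSeries + g.val.toSeries ^ (i + 1) * r.subst g.val.toSeries := by
    rw [← sub_add_cancel f.val.toSeries X, hr, PowerSeries.subst_add hsub,
      PowerSeries.subst_mul hsub, PowerSeries.subst_pow hsub, PowerSeries.subst_X hsub, add_comm]
  have h2 : g.val.toSeries = X * (1 + X ^ i * s) := by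
    rw [← sub_add_cancel g.val.toSeries X, hs]
    ring
  have hc (t : A⟦X⟧) : constantCoeff ((1 + X ^ i * s) ^ (i + 1) * t) = constantCoeff t := by
    simp [hi]
  have h3 : constantCoeff (r.subst g.val.toSeries : A⟦X⟧) = constantCoeff r := by
    have h := X_pow_dvd_subst_sub_subst (f := r) (g := C (constantCoeff r)) (m := 1) (by
      rw [pow_one, X_dvd_iff]; simp) g.val.X_dvd
    rw [PowerSeries.subst_C, pow_one, X_dvd_iff, map_sub, sub_eq_zero] at h
    exact h.trans (constantCoeff_C _)
  have h4 : coeff (i + 1) f.val.toSeries = constantCoeff r := by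
    rw [← sub_add_cancel f.val.toSeries X, hr, map_add, coeff_X, if_neg (by omega),
      _root_.add_zero, coeff_X_pow_mul', if_pos le_rfl, Nat.sub_self, coeff_zero_eq_constantCoeff]
  rw [Units.val_mul, Endo.mul_toSeries, h1, map_add, h4, add_comm]
  congr 1
  conv_lhs => rw [h2, mul_pow, mul_assoc, ← h2, coeff_X_pow_mul', if_pos le_rfl, Nat.sub_self,
    coeff_zero_eq_constantCoeff, hc, h3]

/-- The coefficient of `T`, as a homomorphism. -/
def coeffOneHom (F : FormalGroup A) : F.Endo →* A where
  toFun f := coeff 1 f.toSeries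
  map_one' := coeff_one_X
  map_mul' := Endo.coeff_one_mul

end Coeff

section Iso

variable {p h : ℕ} [Fact p.Prime] {A : Type*} [CommRing A] {F : FormalGroup A}

/-- The homomorphism `f ↦ a₁` on automorphisms `f(T) = a₁ T + ⋯`. -/
def leadHomZero (hA : (p : A) = 0) (hF : F.bracket p = X ^ p ^ h) :
    F.autFil 0 →* rootsOfUnity (p ^ h - 1) A :=
  ((Units.map F.coeffOneHom).comp (F.autFil 0).subtype).codRestrict _ fun f => by
    rw [mem_rootsOfUnity]
    -- The identity a^(p^h) = a becomes a^(p^h - 1) = 1 after cancelling the unit a.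
    refine mul_right_cancel (b := Units.map F.coeffOneHom f.val) ?_
    rw [one_mul]
    change Units.map F.coeffOneHom f.val ^ (p ^ h - 1) * _ = _
    rw [← pow_succ,
      Nat.sub_add_cancel (Nat.one_le_pow _ _ (Fact.out : p.Prime).pos)]
    exact Units.ext (Endo.coeff_pow_eq hA hF f.val.val 1)

theorem leadHomZero_val (hA : (p : A) = 0) (hF : F.bracket p = X ^ p ^ h) (f : F.autFil 0) :
    (leadHomZero hA hF f).val.val = coeff 1 f.val.val.toSeries := rfl

theorem ker_leadHomZero (hA : (p : A) = 0) (hF : F.bracket p = X ^ p ^ h) :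
    (leadHomZero hA hF).ker = (F.autFil 1).subgroupOf (F.autFil 0) := by
  ext f
  rw [MonoidHom.mem_ker, Subgroup.mem_subgroupOf, mem_autFil, Subtype.ext_iff, Units.ext_iff,
    leadHomZero_val]
  constructor
  · intro hf k hk
    rcases Nat.le_one_iff_eq_zero_or_eq_one.mp hk with rfl | rfl
    · exact f.2 0 le_rfl
    · exact hf.trans coeff_one_X.symm
  · intro hf
    exact (hf 1 le_rfl).trans coeff_one_X

/-- The homomorphism `f ↦ a` on automorphisms `f(T) = T + a T ^ n + ⋯`, where `n ≥ 2`. -/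
def leadHom (hA : (p : A) = 0) (hF : F.bracket p = X ^ p ^ h) {n : ℕ} (hn : 2 ≤ n) :
    F.autFil (n - 1) →* Multiplicative (frobFixed p h A hA) where
  toFun f := Multiplicative.ofAdd ⟨coeff n f.val.val.toSeries, f.val.val.coeff_pow_eq hA hF n⟩
  map_one' := by
    refine Multiplicative.toAdd.injective (Subtype.ext ?_)
    change coeff n (X : A⟦X⟧) = 0
    rw [coeff_X, if_neg (by omega)]
  map_mul' f g := by
    refine Multiplicative.toAdd.injective (Subtype.ext ?_)
    have := coeff_mul_of_mem_autFil (by omega) f.2 g.2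
    rw [Nat.sub_add_cancel (by omega)] at this
    exact this

theorem leadHom_val (hA : (p : A) = 0) (hF : F.bracket p = X ^ p ^ h) {n : ℕ} (hn : 2 ≤ n)
    (f : F.autFil (n - 1)) :
    (Multiplicative.toAdd (leadHom hA hF hn f)).val = coeff n f.val.val.toSeries := rfl

theorem mem_autFil_succ_iff {n : ℕ} (hn : 2 ≤ n) (f : F.autFil (n - 1)) :
    f.val ∈ F.autFil (n - 1 + 1) ↔ coeff n f.val.val.toSeries = 0 := by
  rw [mem_autFil]
  have hX : coeff n (X : A⟦X⟧) = 0 := by rw [coeff_X, if_neg (by omega)]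
  constructor
  · intro hf
    exact (hf n (by omega)).trans hX
  · intro hf k hk
    rcases Nat.lt_or_ge (n - 1) k with h1 | h1
    · obtain rfl : k = n := by omega
      rw [hf, hX]
    · exact f.2 k h1

theorem ker_leadHom (hA : (p : A) = 0) (hF : F.bracket p = X ^ p ^ h) {n : ℕ} (hn : 2 ≤ n) :
    (leadHom hA hF hn).ker = (F.autFil (n - 1 + 1)).subgroupOf (F.autFil (n - 1)) := by
  ext f
  rw [MonoidHom.mem_ker, Subgroup.mem_subgroupOf, mem_autFil_succ_iff hn,
    ← Multiplicative.toAdd.injective.eq_iff, Subtype.ext_iff, leadHom_val]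
  rfl

theorem subsingleton_autGr (hA : (p : A) = 0) {i : ℕ} (hi : i ≠ 0)
    (hnp : ∀ j, 1 ≤ j → i ≠ p ^ j - 1) : Subsingleton (F.autGr i) := by
  obtain ⟨n, hn, rfl⟩ : ∃ n, 2 ≤ n ∧ i = n - 1 := ⟨i + 1, by omega, rfl⟩
  refine QuotientGroup.subsingleton_iff.mpr ((Subgroup.eq_top_iff' _).mpr fun f => ?_)
  have hf := mem_autFil_iff_X_pow_dvd.mp f.2
  rw [Nat.sub_add_cancel (by omega)] at hf
  have h1 := f.val.val.coeff_eq_zero_of_X_pow_dvd hA (by omega) hf fun j hj => by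
    rcases Nat.eq_zero_or_pos j with rfl | hj0
    -- The power p^0 = 1 is excluded since n ≥ 2.
    · rw [pow_zero] at hj
      omega
    · exact hnp j hj0 (by rw [hj])
  rw [Subgroup.mem_subgroupOf, mem_autFil_succ_iff hn]
  rwa [map_sub, coeff_X, if_neg (by omega), sub_zero] at h1

variable {H : FormalGroup (ZMod p)} [H.IsComm]

/-- Descent to the Frobenius-fixed subring, where the construction of endomorphisms applies;
elements of the prime field are fixed by every power of Frobenius. -/
theorem exists_map_eq_map (φ : ZMod p →+* A) (hA : (p : A) = 0)
    (hH : H.bracket p = X ^ p ^ h) :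
    ∃ G : FormalGroup (frobFixedSubring p h A hA), G.IsComm ∧ G.bracket p = X ^ p ^ h ∧
      G.map (frobFixedSubring p h A hA).subtype = H.map φ := by
  have hφ (x : ZMod p) : φ x ∈ frobFixedSubring p h A hA := by
    change φ x ^ p ^ h = φ x
    rw [← map_pow, ZMod.pow_card_pow]
  refine ⟨H.map (φ.codRestrict _ hφ), inferInstance, ?_, ?_⟩
  · rw [bracket_map, hH, map_pow, PowerSeries.map_X]
  · refine FormalGroup.ext ?_
    ext n
    rfl

theorem frobFixedSubring_pow_eq (hA : (p : A) = 0) (a : frobFixedSubring p h A hA) :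
    a ^ p ^ h = a := Subtype.ext a.2

theorem frobFixedSubring_natCast (hA : (p : A) = 0) : (p : frobFixedSubring p h A hA) = 0 :=
  Subtype.ext (by simpa using hA)

/-- A root of unity lies in the fixed subring, where it is the linear coefficient of an
endomorphism. Invertibility is checked only after base change to `A`. -/
theorem leadHomZero_surjective (φ : ZMod p →+* A) (hA : (p : A) = 0)
    (hH : H.bracket p = X ^ p ^ h) (hF : (H.map φ).bracket p = X ^ p ^ h) :
    Function.Surjective (leadHomZero hA hF) := by
  intro a
  obtain ⟨G, hG, hGp, hGm⟩ := exists_map_eq_map φ hA hH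
  have ha : a.val.val ∈ frobFixedSubring p h A hA := by
    change a.val.val ^ p ^ h = a.val.val
    refine (pow_sub_one_mul (pow_ne_zero h (Fact.out : p.Prime).ne_zero) _).symm.trans ?_
    rw [← Units.val_pow_eq_pow_val, (mem_rootsOfUnity _ _).mp a.2, Units.val_one, one_mul]
  obtain ⟨f, hf⟩ := exists_endo_coeff_one_eq G (frobFixedSubring_natCast hA)
    (frobFixedSubring_pow_eq hA) hGp ⟨_, ha⟩
  have hc : coeff 1 (Endo.map _ hGm f).toSeries = a.val.val := by
    rw [Endo.map_toSeries, coeff_map, hf]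
    rfl
  obtain ⟨u, hu⟩ := (Endo.map _ hGm f).isUnit_of_isUnit_coeff_one (hc ▸ a.val.isUnit)
  refine ⟨⟨u, by rw [autFil_zero]; trivial⟩, Subtype.ext (Units.ext ?_)⟩
  rw [leadHomZero_val, ← hc, ← hu]

theorem leadHom_surjective (φ : ZMod p →+* A) (hA : (p : A) = 0)
    (hH : H.bracket p = X ^ p ^ h) (hF : (H.map φ).bracket p = X ^ p ^ h) {j : ℕ}
    (hj : 2 ≤ p ^ j) : Function.Surjective (leadHom hA hF hj) := by
  intro a
  obtain ⟨G, hG, hGp, hGm⟩ := exists_map_eq_map φ hA hH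
  obtain ⟨f, hf⟩ := exists_endo_eq_X_add G (frobFixedSubring_natCast hA)
    (frobFixedSubring_pow_eq hA) hGp ⟨_, a.toAdd.2⟩ j
  have hc (k : ℕ) (hk : k < p ^ j + 1) : coeff k (Endo.map _ hGm f).toSeries =
      coeff k (X + C a.toAdd.val * X ^ p ^ j) := by
    have h1 := X_pow_dvd_iff.mp hf k hk
    rw [map_sub, sub_eq_zero] at h1
    rw [Endo.map_toSeries, coeff_map, h1, ← coeff_map]
    simp
  have h1 : coeff 1 (Endo.map _ hGm f).toSeries = 1 := by
    rw [hc 1 (by omega), map_add, coeff_one_X, coeff_C_mul, coeff_X_pow, if_neg (by omega),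
      mul_zero, _root_.add_zero]
  obtain ⟨u, hu⟩ := (Endo.map _ hGm f).isUnit_of_isUnit_coeff_one (h1 ▸ isUnit_one)
  refine ⟨⟨u, fun k hk => ?_⟩, Multiplicative.toAdd.injective (Subtype.ext ?_)⟩
  · rw [hu, hc k (by omega), map_add, coeff_C_mul, coeff_X_pow, if_neg (by omega),
      mul_zero, _root_.add_zero]
  · rw [leadHom_val, hu, hc _ (by omega), map_add, coeff_C_mul, coeff_X_pow_self, mul_one, coeff_X,
      if_neg (by omega), _root_.zero_add]

end Iso

end FormalGroup

/-- The isomorphism `G ⧸ N ≃* K` induced by a surjection `G →* K` with kernel `N`. -/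
def quotientMulEquivOfKerEq {G K : Type*} [Group G] [Group K] (φ : G →* K) (N : Subgroup G)
    [N.Normal] (hN : φ.ker = N) (hφ : Function.Surjective φ) : G ⧸ N ≃* K :=
  (QuotientGroup.quotientMulEquivOfEq hN.symm).trans
    (QuotientGroup.quotientKerEquivOfSurjective φ hφ)

/-! ### The isomorphisms of presheaves -/

namespace AutH

open FormalGroup

variable {p h : ℕ} [Fact p.Prime] {H : FormalGroup (ZMod p)}

theorem bracket_lawOver (hH : H.bracket p = PowerSeries.X ^ p ^ h)
    (S : Over (baseScheme.{u} p)) : (lawOver H S).bracket p = PowerSeries.X ^ p ^ h := by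
  rw [lawOver, bracket_map, hH, map_pow, PowerSeries.map_X]

variable [H.IsComm]

/-- The isomorphism `A_0 / A_1 ≅ μ_{p^h - 1}`. -/
def grIsoZero (hH : H.bracket p = PowerSeries.X ^ p ^ h) :
    grPresheaf.{u} H 0 ≅ muPresheaf.{u} p (p ^ h - 1) :=
  NatIso.ofComponents
    (fun S => (quotientMulEquivOfKerEq (leadHomZero (natCast_glob S.unop)
      (bracket_lawOver hH S.unop)) _ (ker_leadHomZero _ _)
      (leadHomZero_surjective (structMap S.unop) _ hH _)).toGrpIso)
    fun g => by
      refine GrpCat.hom_ext (MonoidHom.ext fun x => ?_)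
      obtain ⟨f, rfl⟩ := QuotientGroup.mk_surjective x
      exact Subtype.ext (Units.ext (coeff_autFilMap (globMap g.unop) (lawOver_map H g.unop) 0 f 1))

/-- The isomorphism `A_{n-1} / A_n ≅ 𝔾_a^{Fr}` for `n = p ^ j`, `j ≥ 1`. -/
def grIso (hH : H.bracket p = PowerSeries.X ^ p ^ h) {j : ℕ} (hj : 2 ≤ p ^ j) :
    grPresheaf.{u} H (p ^ j - 1) ≅ gaFrobPresheaf.{u} p h :=
  NatIso.ofComponents
    (fun S => (quotientMulEquivOfKerEq (leadHom (natCast_glob S.unop)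
      (bracket_lawOver hH S.unop) hj) _ (ker_leadHom _ _ _)
      (leadHom_surjective (structMap S.unop) _ hH _ _)).toGrpIso)
    fun g => by
      refine GrpCat.hom_ext (MonoidHom.ext fun x => ?_)
      obtain ⟨f, rfl⟩ := QuotientGroup.mk_surjective x
      exact Multiplicative.toAdd.injective (Subtype.ext
        (coeff_autFilMap (globMap g.unop) (lawOver_map H g.unop) (p ^ j - 1) f (p ^ j)))

end AutH

end

theorem mainTheorem6 (p h : ℕ) [Fact p.Prime] (hh : 1 ≤ h)
    (H : FormalGroup (ZMod p)) [H.IsComm] (hH : H.bracket p = PowerSeries.X ^ p ^ h) :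
    (∃ e : AutH.grPresheaf.{u} H 0 ≅ AutH.muPresheaf.{u} p (p ^ h - 1),
      ∀ (S : Over (AutH.baseScheme.{u} p)) (f : (AutH.lawOver H S).autFil 0),
        ((e.hom.app (op S)).hom (QuotientGroup.mk f) :
          rootsOfUnity (p ^ h - 1) (AutH.glob S)).val.val =
            PowerSeries.coeff 1 f.val.val.toSeries) ∧
    (∀ j : ℕ, 1 ≤ j →
      ∃ e : AutH.grPresheaf.{u} H (p ^ j - 1) ≅ AutH.gaFrobPresheaf.{u} p h,
        ∀ (S : Over (AutH.baseScheme.{u} p)) (f : (AutH.lawOver H S).autFil (p ^ j - 1)),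
          (Multiplicative.toAdd ((e.hom.app (op S)).hom (QuotientGroup.mk f) :
            Multiplicative (frobFixed p h (AutH.glob S) (AutH.natCast_glob S)))).val =
              PowerSeries.coeff (p ^ j) f.val.val.toSeries) ∧
    (∀ i : ℕ, i ≠ 0 → (∀ j : ℕ, 1 ≤ j → i ≠ p ^ j - 1) →
      Limits.IsZero (AutH.grPresheaf.{u} H i)) := by
  refine ⟨⟨AutH.grIsoZero hH, fun S f => rfl⟩, fun j hj => ?_, fun i hi hij => ?_⟩
  · have hp : 2 ≤ p ^ j :=
      (Fact.out : p.Prime).two_le.trans (Nat.le_self_pow (by omega) p)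
    exact ⟨AutH.grIso hH hp, fun S f => rfl⟩
  · refine Functor.isZero _ fun S => ?_
    have := FormalGroup.subsingleton_autGr (F := AutH.lawOver H S.unop)
      (AutH.natCast_glob S.unop) hi hij
    exact GrpCat.isZero_of_subsingleton (GrpCat.of ((AutH.lawOver H S.unop).autGr i))
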